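/- **Setting.** Let $n\ge 2$. Call $f:[0,1]^n\to\mathbb{R}_{\ge 0}$ *DR-submodular* if $f(x+\delta \mathbf 1_i)-f(x)\ge f(y+\delta\mathbf 1_i)-f(y)$ for all $x\le y$ in $[0,1]^n$, all $i\in[n]$ and all $\delta\in[0,1]$ with $x+\delta\mathbf 1_i,\,y+\delta\mathbf 1_i\in[0,1]^n$. Let $r:2^{[n]}\to\mathbb{R}_{\ge 0}$ be monotone, submodular and satisfy $r(\emptyset)=0$, and let $\mathbf P=\{x\ge 0:\ \sum_{i\in S}x_i\le r(S)\ \forall S\subseteq[n]\}$ be its polymatroid; if $r$ is the rank function of a matroid, $\mathbf P$ is the matroid polytope. The problem is to maximize $f$ over $\mathbf P\cap[0,1]^n$; let $x^*$ be an optimal solution. An algorithm (which knows $n$, $\varepsilon$ and $r$) accesses $f$ only through oracles for $f$ and $\nabla f$ on $[0,1]^n$. It works in adaptive rounds: in each round it submits finitely many query points, which depend only on the answers of earlier rounds, and receives the values of $f$ and $\nabla f$ at these points. The number of evaluations is the total number of query points over all rounds. **Theorem.** For every $c\in\mathbb{R}$ and $k\in\mathbb{N}$ there is a constant $C$ such that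 for every $n\ge 2$, every $\varepsilon>0$ and every $r$ as above there is a deterministic algorithm that, for every differentiable DR-submodular $f:[0,1]^n\to\mathbb{R}_{\ge0}$, stops and returns a point $z\in\mathbf P\cap[0,1]^n$ with - $f(z)\ge(1-1/e-\varepsilon)\,f(x^*)$ if $f$ is monotone, and $f(z)\ge(1/e-\varepsilon)\,f(x^*)$ in general; - if moreover $\nabla_i f(x)\le c\,(n/\varepsilon)^k f(x^*)$ for all $x\in[0,1]^n$ and $i\in[n]$, then both the number of adaptive rounds and the number of evaluations of $f$ and $\nabla f$ are at most $C\log^2 n/\varepsilon^3$. The gradient assumption holds when $f$ is the multilinear extension $f(x)=\sum_{S}g(S)\prod_{i\in S}x_i\prod_{i\notin S}(1-x_i)$ of a nonnegative submodular set function $g:2^{[n]}\to\mathbb{R}_{\ge 0}$ and $r(\{i\})\ge 1$ for all $i$ (for a matroid: there are no loops); in that case $\nabla_i f(x)\le f(x^*)$ for all $x\in[0,1]^n$ and $i\in[n]$. -/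

import Mathlib

namespace DRMax

/-- The unit cube `[0,1]^n`. -/
def cube (n : ℕ) : Set (Fin n → ℝ) := Set.Icc 0 1

/-- Diminishing returns submodularity on `[0,1]^n`. -/
def IsDRSubmodular {n : ℕ} (f : (Fin n → ℝ) → ℝ) : Prop :=
  ∀ x ∈ cube n, ∀ y ∈ cube n, x ≤ y → ∀ i : Fin n, ∀ δ ∈ Set.Icc (0 : ℝ) 1,
    x + Pi.single i δ ∈ cube n → y + Pi.single i δ ∈ cube n →
      f (y + Pi.single i δ) - f y ≤ f (x + Pi.single i δ) - f x

/-- Normalized, monotone, submodular set functions (such functions are nonnegative). -/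
structure IsPolymatroidRank {n : ℕ} (r : Finset (Fin n) → ℝ) : Prop where
  empty : r ∅ = 0
  mono : ∀ S T, S ⊆ T → r S ≤ r T
  submodular : ∀ S T, r (S ∪ T) + r (S ∩ T) ≤ r S + r T

/-- The polymatroid `{x ≥ 0 : x(S) ≤ r(S) for all S}`; if `r` is the rank function of a matroid,
this is the matroid polytope. -/
def polymatroid {n : ℕ} (r : Finset (Fin n) → ℝ) : Set (Fin n → ℝ) :=
  {x | 0 ≤ x ∧ ∀ S : Finset (Fin n), ∑ i ∈ S, x i ≤ r S}

/-- The rank function of a matroid is a polymatroid rank function. -/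
theorem isPolymatroidRank_matroid {n : ℕ} (M : Matroid (Fin n)) :
    IsPolymatroidRank (fun S : Finset (Fin n) => ((M.eRk (S : Set (Fin n))).toNat : ℝ)) := by
  have hfin : ∀ S : Finset (Fin n), M.eRk (S : Set (Fin n)) ≠ ⊤ := fun S =>
    ne_top_of_le_ne_top (Set.encard_ne_top_iff.2 S.finite_toSet)
      (M.eRk_le_encard (S : Set (Fin n)))
  refine ⟨by simp, fun S T h => ?_, fun S T => ?_⟩
  · exact_mod_cast ENat.toNat_le_toNat (M.eRk_mono (by exact_mod_cast h)) (hfin T)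
  · have h := M.eRk_inter_add_eRk_union_le (S : Set (Fin n)) (T : Set (Fin n))
    rw [← Finset.coe_inter, ← Finset.coe_union, ← ENat.natCast_toNat (hfin (S ∩ T)),
      ← ENat.natCast_toNat (hfin (S ∪ T)), ← ENat.natCast_toNat (hfin S), ← ENat.natCast_toNat (hfin T)] at h
    have h' : (M.eRk ((S ∩ T : Finset (Fin n)) : Set (Fin n))).toNat
        + (M.eRk ((S ∪ T : Finset (Fin n)) : Set (Fin n))).toNat
        ≤ (M.eRk (S : Set (Fin n))).toNat + (M.eRk (T : Set (Fin n))).toNat := by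
      exact_mod_cast h
    have h'' := (Nat.cast_le (α := ℝ)).2 h'
    rw [Nat.cast_add, Nat.cast_add] at h''
    linarith

/-- The feasible points: the points of the polymatroid that lie in the domain `[0,1]^n`. -/
def feasible {n : ℕ} (r : Finset (Fin n) → ℝ) : Set (Fin n → ℝ) := polymatroid r ∩ cube n

/-- The gradient of `f` on `[0,1]^n` (one-sided at boundary points). -/
noncomputable def grad {n : ℕ} (f : (Fin n → ℝ) → ℝ) (x : Fin n → ℝ) : Fin n → ℝ :=
  fun i => fderivWithin ℝ f (cube n) x (Pi.single i 1)

/-- Submodularity (diminishing returns) of a set function. -/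
def IsSubmodular {n : ℕ} (g : Finset (Fin n) → ℝ) : Prop :=
  ∀ A B : Finset (Fin n), A ⊆ B → ∀ v ∉ B, g (insert v B) - g B ≤ g (insert v A) - g A

/-- The multilinear extension of a set function. -/
def multilinearExt {n : ℕ} (g : Finset (Fin n) → ℝ) (x : Fin n → ℝ) : ℝ :=
  ∑ S : Finset (Fin n), g S * ((∏ i ∈ S, x i) * ∏ i ∈ Sᶜ, (1 - x i))

/-- A deterministic adaptive algorithm with oracle access to a function on `[0,1]^n` and its
gradient. It either stops with an output, or performs a round: it submits `m` points, all chosen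
before any answer of this round is seen, receives the value and the whole gradient at each of
them, and continues depending on the answers. As the type is inductive, every run is finite. -/
inductive Algorithm (n : ℕ) : Type
  | output (z : Fin n → ℝ) : Algorithm n
  | round (m : ℕ) (q : Fin m → cube n) (next : (Fin m → ℝ × (Fin n → ℝ)) → Algorithm n) :
      Algorithm n

/-- The answer of the oracles for `f` and its gradient at a point. -/
noncomputable def oracle {n : ℕ} (f : (Fin n → ℝ) → ℝ) (x : cube n) : ℝ × (Fin n → ℝ) :=
  (f x, grad f x)

namespace Algorithm

/-- The output of the algorithm on the input function `f`. -/
noncomputable def result {n : ℕ} (f : (Fin n → ℝ) → ℝ) : Algorithm n → (Fin n → ℝ)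
  | output z => z
  | round _ q next => result f (next fun j => oracle f (q j))

/-- The number of adaptive rounds on the input function `f`. -/
noncomputable def rounds {n : ℕ} (f : (Fin n → ℝ) → ℝ) : Algorithm n → ℕ
  | output _ => 0
  | round _ q next => rounds f (next fun j => oracle f (q j)) + 1

/-- The total number of points, over all rounds, at which `f` and its gradient are evaluated. -/
noncomputable def evaluations {n : ℕ} (f : (Fin n → ℝ) → ℝ) : Algorithm n → ℕ
  | output _ => 0
  | round m q next => evaluations f (next fun j => oracle f (q j)) + m

end Algorithm

end DRMax

/-!
Along comparable points a differentiable DR-submodular function is concave and its gradient is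
antitone. Measured continuous greedy moves `x` in `N ≈ 8 / ε` phases to `x i + (1 - x i) * y i / N`,
for directions `y` in the polymatroid; the damping `1 - x i` keeps `x` so small that
`f (x ⊔ z) ≥ (1 - 1 / N) ^ j * f z` after `j` phases. If each phase gains `(f (x ⊔ z) - f x) / N` up
to small errors, the recurrence yields `1 / e`, and `1 - 1 / e` for monotone `f`.

A direction is found in polylogarithmically many rounds. Thresholds for the damped gradient
`(1 - x i) * ∂ᵢ f` decrease geometrically; in a round, the coordinates above the threshold grow as
far as the polymatroid allows, but at most to their double plus a tiny offset. The gradient is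
queried at the point that this largest possible growth would reach, so by antitonicity it bounds the
gain from below, and after logarithmically many doublings every coordinate above the threshold is
saturated. Submodularity of the rank then bounds the mass that a competitor has on the saturated
coordinates by the mass already spent, so that lowering the threshold costs no more than has been
gained.

The number of thresholds depends on the ratio of the largest partial derivative to the optimum. It
is estimated by one extra round: the gradient is largest at the origin, and the point with
coordinates `min 1 (r {i}) / n` is feasible and has at least the fraction `1 / (2 * n)` of the
optimal value. The algorithm therefore knows neither `c` nor `k`, and under the gradient assumption
the ratio is polynomial in `n / ε`. One `ε` of the `ε ^ 3` comes from `log² (1 / ε) ≤ 4 / ε`.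
-/

namespace DRMax

open Filter Topology

variable {n : ℕ}

section Calculus

variable {f : (Fin n → ℝ) → ℝ} {x y w : Fin n → ℝ} {i : Fin n}

theorem mem_cube_iff : x ∈ cube n ↔ ∀ i, 0 ≤ x i ∧ x i ≤ 1 := by
  simp only [cube, Set.mem_Icc, Pi.le_def, Pi.zero_apply, Pi.one_apply, forall_and]

theorem zero_mem_cube : (0 : Fin n → ℝ) ∈ cube n := ⟨le_rfl, zero_le_one⟩

theorem convex_cube : Convex ℝ (cube n) := convex_Icc _ _

theorem update_mem_cube (hx : x ∈ cube n) {t : ℝ} (ht : t ∈ Set.Icc (0 : ℝ) 1) :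
    Function.update x i t ∈ cube n :=
  ⟨le_update_iff.2 ⟨ht.1, fun j _ => hx.1 j⟩, update_le_iff.2 ⟨ht.2, fun j _ => hx.2 j⟩⟩

theorem update_add_single (x : Fin n → ℝ) (i : Fin n) (s δ : ℝ) :
    Function.update x i s + Pi.single i δ = Function.update x i (s + δ) := by
  ext j
  rcases eq_or_ne j i with rfl | h <;> simp [*]

theorem fderivWithin_apply_eq_sum_grad (f : (Fin n → ℝ) → ℝ) (x d : Fin n → ℝ) :
    fderivWithin ℝ f (cube n) x d = ∑ i, d i * grad f x i := by
  conv_lhs => rw [pi_eq_sum_univ' d]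
  simp only [map_sum, map_smul, smul_eq_mul, grad, Pi.single]

theorem hasDerivWithinAt_update (hf : DifferentiableOn ℝ f (cube n)) (hx : x ∈ cube n) {t : ℝ}
    (ht : t ∈ Set.Icc (0 : ℝ) 1) :
    HasDerivWithinAt (fun s => f (Function.update x i s)) (grad f (Function.update x i t) i)
      (Set.Icc 0 1) t :=
  (hf _ (update_mem_cube hx ht)).hasFDerivWithinAt.comp_hasDerivWithinAt t
    (hasDerivAt_update x i t).hasDerivWithinAt fun _ hs => update_mem_cube hx hs

theorem exists_mean_value (hf : DifferentiableOn ℝ f (cube n)) (hx : x ∈ cube n)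
    (hy : y ∈ cube n) (hxy : x ≤ y) :
    ∃ z ∈ Set.Icc x y, f y - f x = ∑ i, (y i - x i) * grad f z i := by
  obtain ⟨z, hz, h⟩ := domain_mvt (fun z hz => (hf z hz).hasFDerivWithinAt) convex_cube hx hy
  exact ⟨z, segment_subset_Icc hxy hz, h.trans (fderivWithin_apply_eq_sum_grad f z (y - x))⟩

/-- Differentiable DR-submodular functions on the cube, the class in which first-order information
controls values: along comparable points they are concave. Nonnegativity is kept separate. -/
structure IsSmoothDR (f : (Fin n → ℝ) → ℝ) : Prop where
  diff : DifferentiableOn ℝ f (cube n)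
  dr : IsDRSubmodular f

namespace IsSmoothDR

theorem antitoneOn_increment (hf : IsSmoothDR f) (hx : x ∈ cube n) (hy : y ∈ cube n)
    (hxy : x ≤ y) {δ : ℝ} (hδ : 0 ≤ δ) :
    AntitoneOn (fun t => f (Function.update y i (t + δ)) - f (Function.update x i t))
      (Set.Icc 0 (1 - δ)) := by
  intro s hs t ht hst
  have h := hf.dr _ (update_mem_cube (i := i) hx (t := s) ⟨hs.1, by linarith [hs.2]⟩) _
    (update_mem_cube hy (t := s + δ) ⟨by linarith [hs.1], by linarith [hs.2]⟩)
    (update_le_update_iff.2 ⟨by linarith, fun j _ => hxy j⟩) i (t - s)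
    ⟨by linarith, by linarith [hs.1, ht.2]⟩
  rw [update_add_single, update_add_single] at h
  have h' := h (update_mem_cube hx ⟨by linarith [ht.1], by linarith [ht.2]⟩)
    (update_mem_cube hy ⟨by linarith [ht.1], by linarith [ht.2]⟩)
  rw [show s + δ + (t - s) = t + δ by ring, add_sub_cancel] at h'
  simp only
  linarith

theorem grad_le_of_sub_lt_one (hf : IsSmoothDR f) (hx : x ∈ cube n) (hy : y ∈ cube n)
    (hxy : x ≤ y) (hi : y i - x i < 1) : grad f y i ≤ grad f x i := by
  obtain ⟨δ, hδ⟩ : ∃ δ, y i - x i = δ := ⟨_, rfl⟩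
  rw [hδ] at hi
  have hxi := mem_cube_iff.1 hx i
  have hyi := mem_cube_iff.1 hy i
  have hδ0 : 0 ≤ δ := by linarith [hxy i]
  have hsub : Set.Icc (0 : ℝ) (1 - δ) ⊆ Set.Icc 0 1 :=
    Set.Icc_subset_Icc_right (by linarith)
  have hdy := hasDerivWithinAt_update (i := i) hf.diff hy (t := x i + δ)
    ⟨by linarith, by linarith⟩
  have hdx := hasDerivWithinAt_update (i := i) hf.diff hx hxi
  rw [Function.update_eq_self] at hdx
  rw [show x i + δ = y i by linarith, Function.update_eq_self,
    show y i = x i + δ by linarith] at hdy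
  have hshift : HasDerivWithinAt (fun t : ℝ => t + δ) 1 (Set.Icc 0 (1 - δ)) (x i) :=
    ((hasDerivAt_id _).add_const δ).hasDerivWithinAt
  have hmaps : Set.MapsTo (fun t => t + δ) (Set.Icc 0 (1 - δ)) (Set.Icc 0 1) :=
    fun t ht => ⟨by linarith [ht.1], by linarith [ht.2]⟩
  have hd := (hdy.comp (x i) hshift hmaps).sub (hdx.mono hsub)
  have hacc : AccPt (x i) (𝓟 (Set.Icc 0 (1 - δ))) :=
    (uniqueDiffOn_Icc (by linarith) _ ⟨hxi.1, by linarith⟩).accPt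
  have := hd.nonpos_of_antitoneOn hacc (hf.antitoneOn_increment hx hy hxy hδ0)
  linarith

theorem grad_le_grad (hf : IsSmoothDR f) (hx : x ∈ cube n) (hy : y ∈ cube n) (hxy : x ≤ y)
    (i : Fin n) : grad f y i ≤ grad f x i := by
  have hxi := mem_cube_iff.1 hx i
  have hyi := mem_cube_iff.1 hy i
  have hm : Function.update x i ((x i + y i) / 2) ∈ cube n :=
    update_mem_cube hx ⟨by linarith, by linarith⟩
  have hxm : x ≤ Function.update x i ((x i + y i) / 2) :=
    le_update_self_iff.2 (by linarith [hxy i])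
  have hmy : Function.update x i ((x i + y i) / 2) ≤ y :=
    update_le_iff.2 ⟨by linarith [hxy i], fun j _ => hxy j⟩
  calc grad f y i ≤ grad f (Function.update x i ((x i + y i) / 2)) i :=
        hf.grad_le_of_sub_lt_one hm hy hmy (by rw [Function.update_self]; linarith)
    _ ≤ grad f x i :=
        hf.grad_le_of_sub_lt_one hx hm hxm (by rw [Function.update_self]; linarith)

theorem sub_le_sum_grad (hf : IsSmoothDR f) (hx : x ∈ cube n) (hy : y ∈ cube n) (hxy : x ≤ y) :
    f y - f x ≤ ∑ i, (y i - x i) * grad f x i := by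
  obtain ⟨z, hz, h⟩ := exists_mean_value hf.diff hx hy hxy
  rw [h]
  exact Finset.sum_le_sum fun i _ => mul_le_mul_of_nonneg_left
    (hf.grad_le_grad hx ⟨hx.1.trans hz.1, hz.2.trans hy.2⟩ hz.1 i) (sub_nonneg.2 (hxy i))

theorem sum_grad_le_sub (hf : IsSmoothDR f) (hx : x ∈ cube n) (hy : y ∈ cube n) (hxy : x ≤ y) :
    ∑ i, (y i - x i) * grad f y i ≤ f y - f x := by
  obtain ⟨z, hz, h⟩ := exists_mean_value hf.diff hx hy hxy
  rw [h]
  exact Finset.sum_le_sum fun i _ => mul_le_mul_of_nonneg_left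
    (hf.grad_le_grad ⟨hx.1.trans hz.1, hz.2.trans hy.2⟩ hy hz.2 i) (sub_nonneg.2 (hxy i))

theorem concave_of_le (hf : IsSmoothDR f) (hx : x ∈ cube n) (hy : y ∈ cube n) (hxy : x ≤ y)
    {t : ℝ} (ht : t ∈ Set.Icc (0 : ℝ) 1) :
    (1 - t) * f x + t * f y ≤ f (x + t • (y - x)) := by
  set z := x + t • (y - x)
  have hzi : ∀ i, z i = x i + t * (y i - x i) := fun i => rfl
  have hxz : x ≤ z := fun i => by
    rw [hzi]; nlinarith [mul_nonneg ht.1 (sub_nonneg.2 (hxy i))]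
  have hzy : z ≤ y := fun i => by
    rw [hzi]; nlinarith [mul_nonneg (sub_nonneg.2 ht.2) (sub_nonneg.2 (hxy i))]
  have hzc : z ∈ cube n := ⟨hx.1.trans hxz, hzy.trans hy.2⟩
  have hright : f y - f z ≤ (1 - t) * ∑ i, (y i - x i) * grad f z i :=
    (hf.sub_le_sum_grad hzc hy hzy).trans_eq (by
      rw [Finset.mul_sum]; exact Finset.sum_congr rfl fun i _ => by rw [hzi]; ring)
  have hleft : t * ∑ i, (y i - x i) * grad f z i ≤ f z - f x :=
    (hf.sum_grad_le_sub hx hzc hxz).trans_eq' (by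
      rw [Finset.mul_sum]; exact Finset.sum_congr rfl fun i _ => by rw [hzi]; ring)
  linarith [mul_le_mul_of_nonneg_left hright ht.1,
    mul_le_mul_of_nonneg_left hleft (sub_nonneg.2 ht.2)]

-- The ray from `x` through `w ⊔ x` stays in the cube up to `x + m⁻¹ • (w ⊔ x - x)`, so `w ⊔ x` is
-- a convex combination of `x` and a point of the cube with weight `1 - m` on `x`.
theorem mul_le_sup (hf : IsSmoothDR f) (hf0 : ∀ x ∈ cube n, 0 ≤ f x) (hx : x ∈ cube n) {m : ℝ}
    (hm0 : 0 ≤ m) (hm1 : m ≤ 1) (hw : ∀ i, w i ≤ m) : (1 - m) * f x ≤ f (w ⊔ x) := by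
  rcases hm0.eq_or_lt with rfl | hm0
  · rw [sup_eq_right.2 fun i => (hw i).trans (hx.1 i), sub_zero, one_mul]
  set y := x + m⁻¹ • (w ⊔ x - x) with hy
  have hstep : 0 ≤ m⁻¹ • (w ⊔ x - x) :=
    smul_nonneg (inv_nonneg.2 hm0.le) (sub_nonneg.2 le_sup_right)
  have hxy : x ≤ y := le_add_of_nonneg_right hstep
  have hy1 : y ≤ 1 := fun i => by
    have hxi := mem_cube_iff.1 hx i
    have h : (w ⊔ x) i - x i ≤ m * (1 - x i) := by
      rw [Pi.sup_apply, sub_le_iff_le_add]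
      exact sup_le (by nlinarith [hw i]) (by nlinarith)
    change x i + m⁻¹ * ((w ⊔ x) i - x i) ≤ 1
    linarith [(inv_mul_le_iff₀ hm0).2 h]
  have hyc : y ∈ cube n := ⟨hx.1.trans hxy, hy1⟩
  have hwy : x + m • (y - x) = w ⊔ x := by
    rw [hy, add_sub_cancel_left, smul_inv_smul₀ hm0.ne', add_sub_cancel]
  have := hf.concave_of_le hx hyc hxy ⟨hm0.le, hm1⟩
  rw [hwy] at this
  linarith [mul_nonneg hm0.le (hf0 y hyc)]

end IsSmoothDR

end Calculus

section Polymatroid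

variable {r : Finset (Fin n) → ℝ} {x y y' z u : Fin n → ℝ} {i : Fin n}

theorem IsPolymatroidRank.nonneg (hr : IsPolymatroidRank r) (S : Finset (Fin n)) : 0 ≤ r S :=
  hr.empty ▸ hr.mono ∅ S (Finset.empty_subset S)

theorem mem_feasible_iff :
    x ∈ feasible r ↔ 0 ≤ x ∧ x ≤ 1 ∧ ∀ S : Finset (Fin n), ∑ i ∈ S, x i ≤ r S :=
  ⟨fun h => ⟨h.1.1, h.2.2, h.1.2⟩, fun h => ⟨⟨h.1, h.2.2⟩, h.1, h.2.1⟩⟩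

theorem feasible_subset_cube : feasible r ⊆ cube n := Set.inter_subset_right

theorem zero_mem_feasible (hr : IsPolymatroidRank r) : (0 : Fin n → ℝ) ∈ feasible r :=
  mem_feasible_iff.2 ⟨le_rfl, zero_le_one, fun S => by simpa using hr.nonneg S⟩

theorem mem_feasible_of_le (hy : y ∈ feasible r) (hx : 0 ≤ x) (hxy : x ≤ y) : x ∈ feasible r :=
  mem_feasible_iff.2 ⟨hx, hxy.trans hy.2.2, fun S =>
    (Finset.sum_le_sum fun i _ => hxy i).trans (hy.1.2 S)⟩

theorem isCompact_feasible : IsCompact (feasible r) := by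
  refine isCompact_Icc.inter_left ?_
  simp only [polymatroid, Set.ofPred_and, Set.ofPred_forall]
  exact isClosed_Ici.inter (isClosed_iInter fun S =>
    isClosed_le (continuous_finsetSum _ fun i _ => continuous_apply i) continuous_const)

/-- The coordinate `i` cannot be increased within the feasible set. -/
def IsSaturated (r : Finset (Fin n) → ℝ) (y : Fin n → ℝ) (i : Fin n) : Prop :=
  ∀ δ > 0, y + Pi.single i δ ∉ feasible r

theorem IsSaturated.mono (h : IsSaturated r y i) (hy : 0 ≤ y) (hyy' : y ≤ y') :
    IsSaturated r y' i := fun δ hδ hmem =>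
  h δ hδ (mem_feasible_of_le hmem (add_nonneg hy (Pi.single_nonneg.2 hδ.le))
    (add_le_add_left hyy' _))

theorem IsSaturated.eq_one_or_tight (h : IsSaturated r y i) (hy : y ∈ feasible r) :
    y i = 1 ∨ ∃ S : Finset (Fin n), i ∈ S ∧ ∑ j ∈ S, y j = r S := by
  obtain ⟨hy0, hy1, hyr⟩ := mem_feasible_iff.1 hy
  by_contra! hslack
  have hcube : ∀ᶠ δ in 𝓝[>] (0 : ℝ), δ < 1 - y i :=
    nhdsWithin_le_nhds (Iio_mem_nhds (sub_pos.2 ((hy1 i).lt_of_ne hslack.1)))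
  have hrank : ∀ᶠ δ in 𝓝[>] (0 : ℝ), ∀ S, i ∈ S → δ < r S - ∑ j ∈ S, y j :=
    eventually_all.2 fun S => eventually_imp_distrib_left.2 fun hi =>
      nhdsWithin_le_nhds (Iio_mem_nhds (sub_pos.2 ((hyr S).lt_of_ne (hslack.2 S hi))))
  obtain ⟨δ, ⟨hδ1, hδr⟩, hδ0 : 0 < δ⟩ := ((hcube.and hrank).and self_mem_nhdsWithin).exists
  refine h δ hδ0 (mem_feasible_iff.2
    ⟨add_nonneg hy0 (Pi.single_nonneg.2 hδ0.le), fun j => ?_, fun S => ?_⟩)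
  · rcases eq_or_ne j i with rfl | hj
    · simpa using (lt_sub_iff_add_lt'.1 hδ1).le
    · simpa [hj] using hy1 j
  · simp only [Pi.add_apply, Finset.sum_add_distrib, Finset.sum_pi_single']
    split_ifs with hi
    · linarith [hδr S hi]
    · simpa using hyr S

theorem tight_union (hr : IsPolymatroidRank r) (hy : y ∈ feasible r) {S T : Finset (Fin n)}
    (hS : ∑ j ∈ S, y j = r S) (hT : ∑ j ∈ T, y j = r T) :
    ∑ j ∈ S ∪ T, y j = r (S ∪ T) := by
  have hle := (mem_feasible_iff.1 hy).2.2
  have := Finset.sum_union_inter (s₁ := S) (s₂ := T) (f := y)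
  linarith [hle (S ∪ T), hle (S ∩ T), hr.submodular S T]

theorem exists_greatest_tight (hr : IsPolymatroidRank r) (hy : y ∈ feasible r) :
    ∃ T, IsGreatest {S : Finset (Fin n) | ∑ j ∈ S, y j = r S} T := by
  obtain ⟨T, hT⟩ := Set.Finite.exists_maximal
    (s := {S : Finset (Fin n) | ∑ j ∈ S, y j = r S}) (Set.toFinite _) ⟨∅, by simp [hr.empty]⟩
  exact ⟨T, hT.1, fun S hS => Finset.subset_union_left.trans
    (hT.2 (tight_union hr hy hS hT.1) Finset.subset_union_right)⟩

theorem sum_saturated_le (hr : IsPolymatroidRank r) (hy : y ∈ feasible r) (hz : z ∈ feasible r)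
    {E : Finset (Fin n)} (hE : ∀ i ∈ E, IsSaturated r y i) : ∑ i ∈ E, z i ≤ ∑ i, y i := by
  obtain ⟨T, hT, hmax⟩ := exists_greatest_tight hr hy
  have hone : ∀ i ∈ E \ T, z i ≤ y i := by
    intro i hi
    rw [Finset.mem_sdiff] at hi
    rcases (hE i hi.1).eq_one_or_tight hy with h | ⟨S, hiS, hS⟩
    · exact h ▸ hz.2.2 i
    · exact absurd (hmax hS hiS) hi.2
  calc ∑ i ∈ E, z i ≤ ∑ i ∈ T ∪ E \ T, z i :=
        Finset.sum_le_sum_of_subset_of_nonneg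
          (by rw [Finset.union_sdiff_self_eq_union]; exact Finset.subset_union_right)
          fun i _ _ => hz.2.1 i
    _ = ∑ i ∈ T, z i + ∑ i ∈ E \ T, z i := Finset.sum_union Finset.disjoint_sdiff
    _ ≤ ∑ i ∈ T, y i + ∑ i ∈ E \ T, y i :=
        add_le_add ((hz.1.2 T).trans hT.ge) (Finset.sum_le_sum hone)
    _ = ∑ i ∈ T ∪ E \ T, y i := (Finset.sum_union Finset.disjoint_sdiff).symm
    _ ≤ ∑ i, y i := Finset.sum_le_univ_sum_of_nonneg fun i => hy.2.1 i

/-- `y'` is a maximal feasible point between `y` and the caps `u`. -/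
structure IsMaximalGrowth (r : Finset (Fin n) → ℝ) (y u y' : Fin n → ℝ) : Prop where
  mem : y' ∈ feasible r
  le : y ≤ y'
  le_cap : y' ≤ u
  eq_cap_or_saturated : ∀ i, y' i = u i ∨ IsSaturated r y' i

theorem exists_add_single_mem_of_not_isSaturated (hy : 0 ≤ y) (h : ¬ IsSaturated r y i) {ε : ℝ}
    (hε : 0 < ε) : ∃ δ ∈ Set.Ioc 0 ε, y + Pi.single i δ ∈ feasible r := by
  simp only [IsSaturated, not_forall, not_not] at h
  obtain ⟨δ, hδ, hmem⟩ := h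
  have hpos : 0 < min δ ε := lt_min hδ hε
  have hle : (Pi.single i (min δ ε) : Fin n → ℝ) ≤ Pi.single i δ :=
    Pi.single_le_single.2 (min_le_left _ _)
  exact ⟨min δ ε, ⟨hpos, min_le_right _ _⟩, mem_feasible_of_le hmem
    (add_nonneg hy (Pi.single_nonneg.2 hpos.le)) (add_le_add_right hle _)⟩

theorem exists_isMaximalGrowth (hy : y ∈ feasible r) (hu : y ≤ u) :
    ∃ y', IsMaximalGrowth r y u y' := by
  have hcompact : IsCompact (feasible r ∩ Set.Icc y u) :=
    isCompact_feasible.inter_right isClosed_Icc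
  obtain ⟨y', ⟨hy', hyy', hy'u⟩, hmax⟩ := hcompact.exists_isMaxOn ⟨y, hy, le_rfl, hu⟩
    (f := fun y : Fin n → ℝ => ∑ i, y i)
    (continuous_finsetSum _ fun i _ => continuous_apply i).continuousOn
  refine ⟨y', hy', hyy', hy'u, fun i => or_iff_not_imp_left.2 fun hne => ?_⟩
  by_contra hsat
  obtain ⟨δ, hδ, hmem⟩ := exists_add_single_mem_of_not_isSaturated hy'.2.1 hsat
    (sub_pos.2 ((hy'u i).lt_of_ne hne))
  have hle : y' + Pi.single i δ ≤ u := fun j => by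
    rcases eq_or_ne j i with rfl | hj
    · simpa using le_sub_iff_add_le'.1 hδ.2
    · simpa [hj] using hy'u j
  have := hmax ⟨hmem, hyy'.trans (le_add_of_nonneg_right (Pi.single_nonneg.2 hδ.1.le)), hle⟩
  simp only [Set.mem_ofPred_eq, Pi.add_apply, Finset.sum_add_distrib, Finset.sum_pi_single',
    Finset.mem_univ, if_true] at this
  linarith [hδ.1]

/-- The growth rule of the algorithm: raise `y` to a maximal feasible point below the caps `u`.
Any choice of maximal point is good enough. -/
noncomputable def grow (r : Finset (Fin n) → ℝ) (y u : Fin n → ℝ) : Fin n → ℝ :=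
  Classical.epsilon (IsMaximalGrowth r y u)

theorem isMaximalGrowth_grow (hy : y ∈ feasible r) (hu : y ≤ u) :
    IsMaximalGrowth r y u (grow r y u) :=
  Classical.epsilon_spec (exists_isMaximalGrowth hy hu)

end Polymatroid

namespace Algorithm

variable {f : (Fin n → ℝ) → ℝ}

/-- Sequential composition: run an algorithm and continue with its output. -/
def bind : Algorithm n → ((Fin n → ℝ) → Algorithm n) → Algorithm n
  | output z, k => k z
  | round m q next, k => round m q fun a => bind (next a) k

theorem result_bind (A : Algorithm n) (k : (Fin n → ℝ) → Algorithm n) :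
    (A.bind k).result f = (k (A.result f)).result f := by
  induction A with
  | output _ => rfl
  | round _ _ _ ih => exact ih _

theorem rounds_bind (A : Algorithm n) (k : (Fin n → ℝ) → Algorithm n) :
    (A.bind k).rounds f = A.rounds f + (k (A.result f)).rounds f := by
  induction A with
  | output _ => simp only [bind, rounds, result, zero_add]
  | round _ _ _ ih => simp only [bind, rounds, result, ih]; ring

theorem evaluations_bind (A : Algorithm n) (k : (Fin n → ℝ) → Algorithm n) :
    (A.bind k).evaluations f = A.evaluations f + (k (A.result f)).evaluations f := by
  induction A with
  | output _ => simp only [bind, evaluations, result, zero_add]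
  | round _ _ _ ih => simp only [bind, evaluations, result, ih]; ring

/-- Bounded iteration: apply the subroutines `B 0, …, B (m - 1)` one after the other. -/
def iter (B : ℕ → (Fin n → ℝ) → Algorithm n) : ℕ → (Fin n → ℝ) → Algorithm n
  | 0, y => output y
  | m + 1, y => (iter B m y).bind (B m)

theorem result_iter_succ (B : ℕ → (Fin n → ℝ) → Algorithm n) (m : ℕ) (y : Fin n → ℝ) :
    (iter B (m + 1) y).result f = (B m ((iter B m y).result f)).result f :=
  result_bind _ _

theorem rounds_iter {B : ℕ → (Fin n → ℝ) → Algorithm n} {b : ℕ}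
    (h : ∀ j y, (B j y).rounds f = b) (m : ℕ) (y : Fin n → ℝ) :
    (iter B m y).rounds f = m * b := by
  induction m with
  | zero => rw [zero_mul]; rfl
  | succ m ih => rw [iter, rounds_bind, ih, h, Nat.succ_mul]

theorem evaluations_iter {B : ℕ → (Fin n → ℝ) → Algorithm n} {b : ℕ}
    (h : ∀ j y, (B j y).evaluations f = b) (m : ℕ) (y : Fin n → ℝ) :
    (iter B m y).evaluations f = m * b := by
  induction m with
  | zero => rw [zero_mul]; rfl
  | succ m ih => rw [iter, evaluations_bind, ih, h, Nat.succ_mul]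

end Algorithm

section Greedy

variable {f : (Fin n → ℝ) → ℝ} {r : Finset (Fin n) → ℝ} {x y y' : Fin n → ℝ}

/-- A point as a query point, by clamping its coordinates to `[0,1]`. -/
def toCube (p : Fin n → ℝ) : cube n :=
  ⟨(0 ⊔ p) ⊓ 1, le_inf le_sup_left zero_le_one, inf_le_right⟩

theorem coe_toCube {p : Fin n → ℝ} (hp : p ∈ cube n) : (toCube p : Fin n → ℝ) = p := by
  change (0 ⊔ p) ⊓ 1 = p
  rw [sup_eq_right.2 hp.1, inf_eq_left.2 hp.2]

theorem oracle_toCube {p : Fin n → ℝ} (hp : p ∈ cube n) :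
    oracle f (toCube p) = (f p, grad f p) := by
  rw [oracle, coe_toCube hp]

/-- The damped step of measured continuous greedy: from `x`, a step of size `η` in the direction
`y`, in which the coordinate `i` is scaled by the room `1 - x i` left in it. -/
def move (η : ℝ) (x y : Fin n → ℝ) : Fin n → ℝ := fun i => x i + η * (1 - x i) * y i

/-- The caps for one round of growth: coordinates at most double, up to the offset `τ` that lets
them leave zero. -/
def caps (τ : ℝ) (y : Fin n → ℝ) : Fin n → ℝ := fun i => 2 * y i + τ

/-- Parameters of the algorithm: the step size `η`, the offset `τ` of the caps, the largest
threshold `G`, the number `R` of rounds per threshold and the number `J` of thresholds. -/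
structure Params where
  η : ℝ
  τ : ℝ
  G : ℝ
  R : ℕ
  J : ℕ

/-- The geometrically decreasing thresholds for the damped gradient. -/
def Params.threshold (P : Params) (j : ℕ) : ℝ := P.G * (1 - P.η) ^ j

variable {P : Params} {v : ℝ}

/-- The point of a round at which the gradient is inspected: the step in the direction of the caps,
which bounds every step the round may lead to. -/
def lookahead (P : Params) (x y : Fin n → ℝ) : Fin n → ℝ := move P.η x (caps P.τ y)

/-- The damped gradient of the objective at the lookahead point. -/
noncomputable def weight (f : (Fin n → ℝ) → ℝ) (P : Params) (x y : Fin n → ℝ) : Fin n → ℝ :=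
  (1 - x) * grad f (lookahead P x y)

/-- The caps of a round with threshold `v` and damped gradient `w`: only coordinates of weight at
least `v` may grow. -/
noncomputable def stepCaps (P : Params) (v : ℝ) (w y : Fin n → ℝ) : Fin n → ℝ :=
  fun i => if v ≤ w i then caps P.τ y i else y i

/-- One round: query the lookahead point and let the coordinates of large damped gradient grow. -/
noncomputable def stepAlg (r : Finset (Fin n) → ℝ) (P : Params) (x : Fin n → ℝ) (v : ℝ)
    (y : Fin n → ℝ) : Algorithm n :=
  .round 1 (fun _ => toCube (lookahead P x y)) fun a =>
    .output (grow r y (stepCaps P v ((1 - x) * (a 0).2) y))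

/-- The first `m` rounds for a threshold `v`. -/
noncomputable def levelAlg (r : Finset (Fin n) → ℝ) (P : Params) (x : Fin n → ℝ) (v : ℝ) (m : ℕ) :
    (Fin n → ℝ) → Algorithm n :=
  .iter (fun _ => stepAlg r P x v) m

/-- The direction of a phase that starts at `x`, after the first `j` thresholds. -/
noncomputable def directionAlg (r : Finset (Fin n) → ℝ) (P : Params) (x : Fin n → ℝ) (j : ℕ) :
    Algorithm n :=
  .iter (fun j => levelAlg r P x (P.threshold j) P.R) j 0

/-- A phase: a damped step in the direction computed for the current point. -/
noncomputable def phaseAlg (r : Finset (Fin n) → ℝ) (P : Params) (x : Fin n → ℝ) : Algorithm n :=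
  (directionAlg r P x P.J).bind fun y => .output (move P.η x y)

/-- The accelerated measured continuous greedy algorithm, after `N` phases. -/
noncomputable def greedyAlg (r : Finset (Fin n) → ℝ) (P : Params) (N : ℕ) : Algorithm n :=
  .iter (fun _ => phaseAlg r P) N 0

theorem rounds_greedyAlg (N : ℕ) : (greedyAlg r P N).rounds f = N * (P.J * P.R) := by
  refine Algorithm.rounds_iter (fun _ x => ?_) N 0
  rw [phaseAlg, Algorithm.rounds_bind]
  refine Algorithm.rounds_iter (fun _ y => ?_) P.J 0
  exact (Algorithm.rounds_iter (b := 1) (fun _ _ => rfl) P.R y).trans (mul_one _)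

theorem evaluations_greedyAlg (N : ℕ) :
    (greedyAlg r P N).evaluations f = N * (P.J * P.R) := by
  refine Algorithm.evaluations_iter (fun _ x => ?_) N 0
  rw [phaseAlg, Algorithm.evaluations_bind]
  refine Algorithm.evaluations_iter (fun _ y => ?_) P.J 0
  exact (Algorithm.evaluations_iter (b := 1) (fun _ _ => rfl) P.R y).trans (mul_one _)

theorem result_levelAlg_succ (m : ℕ) : (levelAlg r P x v (m + 1) y).result f =
    (stepAlg r P x v ((levelAlg r P x v m y).result f)).result f :=
  Algorithm.result_iter_succ _ _ _

theorem result_directionAlg_succ (j : ℕ) : (directionAlg r P x (j + 1)).result f =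
    (levelAlg r P x (P.threshold j) P.R ((directionAlg r P x j).result f)).result f :=
  Algorithm.result_iter_succ _ _ _

theorem result_phaseAlg :
    (phaseAlg r P x).result f = move P.η x ((directionAlg r P x P.J).result f) :=
  Algorithm.result_bind _ _

theorem result_greedyAlg_succ (N : ℕ) : (greedyAlg r P (N + 1)).result f =
    move P.η ((greedyAlg r P N).result f)
      ((directionAlg r P ((greedyAlg r P N).result f) P.J).result f) :=
  (Algorithm.result_iter_succ _ _ _).trans result_phaseAlg

theorem move_mono {η : ℝ} (hη : 0 ≤ η) (hx : x ≤ 1) (h : y ≤ y') :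
    move η x y ≤ move η x y' := fun i =>
  add_le_add_right (mul_le_mul_of_nonneg_left (h i) (mul_nonneg hη (sub_nonneg.2 (hx i)))) _

theorem move_zero (η : ℝ) (x : Fin n → ℝ) : move η x 0 = x := by
  ext i
  simp [move]

theorem move_mem_cube {η b : ℝ} (hη : 0 ≤ η) (hb : η * b ≤ 1) (hx : x ∈ cube n) (hy : 0 ≤ y)
    (hyb : ∀ i, y i ≤ b) : move η x y ∈ cube n := by
  refine mem_cube_iff.2 fun i => ?_
  have hxi := mem_cube_iff.1 hx i
  have hroom := sub_nonneg.2 hxi.2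
  have hstep : η * (1 - x i) * y i ≤ 1 - x i := by
    nlinarith [(mul_le_mul_of_nonneg_left (hyb i) hη).trans hb]
  exact ⟨add_nonneg hxi.1 (mul_nonneg (mul_nonneg hη hroom) (hy i)),
    (add_le_add_right hstep _).trans_eq (add_sub_cancel _ _)⟩

theorem caps_mono (τ : ℝ) : Monotone (caps τ : (Fin n → ℝ) → Fin n → ℝ) := fun _ _ h i => by
  simpa [caps] using h i

theorem le_caps {τ : ℝ} (hτ : 0 ≤ τ) (hy : 0 ≤ y) : y ≤ caps τ y := fun i => by
  change y i ≤ 2 * y i + τ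
  linarith [show 0 ≤ y i from hy i]

theorem le_stepCaps (hτ : 0 ≤ P.τ) (hy : 0 ≤ y) (w : Fin n → ℝ) : y ≤ stepCaps P v w y :=
  fun i => by
    rw [stepCaps]
    split_ifs
    exacts [le_caps hτ hy i, le_rfl]

theorem stepCaps_le_caps (hτ : 0 ≤ P.τ) (hy : 0 ≤ y) (w : Fin n → ℝ) :
    stepCaps P v w y ≤ caps P.τ y := fun i => by
  rw [stepCaps]
  split_ifs
  exacts [le_rfl, le_caps hτ hy i]

/-- The range of parameters in which all query points stay in the cube (`6 * η ≤ 1` leaves room for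
the error estimates) and `R` doublings lift a coordinate from `τ` beyond `1`. -/
structure Params.IsValid (P : Params) : Prop where
  η_nonneg : 0 ≤ P.η
  η_le : 6 * P.η ≤ 1
  τ_nonneg : 0 ≤ P.τ
  τ_le : P.τ ≤ 1
  G_nonneg : 0 ≤ P.G
  one_lt : 1 < ((2 : ℝ) ^ P.R - 1) * P.τ

theorem Params.IsValid.threshold_nonneg (hP : P.IsValid) (j : ℕ) : 0 ≤ P.threshold j :=
  mul_nonneg hP.G_nonneg (pow_nonneg (by linarith [hP.η_le, hP.η_nonneg]) j)

theorem Params.IsValid.move_mem_cube (hP : P.IsValid) (hx : x ∈ cube n) (hy : y ∈ cube n) :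
    move P.η x y ∈ cube n :=
  DRMax.move_mem_cube hP.η_nonneg (b := 1) (by linarith [hP.η_le, hP.η_nonneg]) hx hy.1 hy.2

theorem Params.IsValid.lookahead_mem_cube (hP : P.IsValid) (hx : x ∈ cube n) (hy : y ∈ cube n) :
    lookahead P x y ∈ cube n := by
  refine DRMax.move_mem_cube hP.η_nonneg (b := 3) (by linarith [hP.η_le, hP.η_nonneg]) hx
    (hy.1.trans (le_caps hP.τ_nonneg hy.1)) fun i => ?_
  change 2 * y i + P.τ ≤ 3
  linarith [hP.τ_le, (mem_cube_iff.1 hy i).2]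

theorem Params.IsValid.le_lookahead (hP : P.IsValid) (hx : x ∈ cube n) (hy : y ∈ cube n) :
    x ≤ lookahead P x y :=
  (move_zero P.η x).symm.le.trans
    (move_mono hP.η_nonneg hx.2 (hy.1.trans (le_caps hP.τ_nonneg hy.1)))

theorem Params.IsValid.move_le_lookahead (hP : P.IsValid) (hx : x ∈ cube n)
    (hyy' : y' ≤ caps P.τ y) : move P.η x y' ≤ lookahead P x y :=
  move_mono hP.η_nonneg hx.2 hyy'

theorem result_stepAlg (hP : P.IsValid) (hx : x ∈ cube n) (hy : y ∈ cube n) :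
    (stepAlg r P x v y).result f = grow r y (stepCaps P v (weight f P x y) y) := by
  simp only [stepAlg, Algorithm.result, oracle_toCube (hP.lookahead_mem_cube hx hy)]
  rfl

end Greedy

section Direction

variable {f : (Fin n → ℝ) → ℝ} {r : Finset (Fin n) → ℝ} {x y y' z : Fin n → ℝ}
  {P : Params} {v : ℝ} {i : Fin n}

theorem IsSmoothDR.weight_anti (hf : IsSmoothDR f) (hP : P.IsValid) (hx : x ∈ cube n)
    (hy : y ∈ cube n) (hy' : y' ∈ cube n) (h : y ≤ y') (i : Fin n) :
    weight f P x y' i ≤ weight f P x y i :=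
  mul_le_mul_of_nonneg_left (hf.grad_le_grad (hP.lookahead_mem_cube hx hy)
    (hP.lookahead_mem_cube hx hy') (move_mono hP.η_nonneg hx.2 (caps_mono _ h)) i)
    (sub_nonneg.2 (hx.2 i))

/-- Growth from `y` to `y'` that pays for the mass it uses: each unit of mass gains at least `v`,
up to the step size `η`. This is what a round at threshold `v` achieves, and it composes. -/
structure IsEfficientGrowth (r : Finset (Fin n) → ℝ) (f : (Fin n → ℝ) → ℝ) (η : ℝ)
    (x : Fin n → ℝ) (v : ℝ) (y y' : Fin n → ℝ) : Prop where
  mem : y' ∈ feasible r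
  le : y ≤ y'
  gain : η * v * (∑ i, y' i - ∑ i, y i) ≤ f (move η x y') - f (move η x y)

theorem IsEfficientGrowth.refl {η : ℝ} (hy : y ∈ feasible r) :
    IsEfficientGrowth r f η x v y y :=
  ⟨hy, le_rfl, by simp only [sub_self, mul_zero, le_refl]⟩

theorem IsEfficientGrowth.trans {η : ℝ} {y'' : Fin n → ℝ}
    (h : IsEfficientGrowth r f η x v y y') (h' : IsEfficientGrowth r f η x v y' y'') :
    IsEfficientGrowth r f η x v y y'' :=
  ⟨h'.mem, h.le.trans h'.le, by linarith [h.gain, h'.gain]⟩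

namespace IsSmoothDR

theorem growth_of_le_stepCaps (hf : IsSmoothDR f) (hP : P.IsValid) (hx : x ∈ cube n)
    (hy : y ∈ cube n) (hy' : y' ∈ feasible r) (hyy' : y ≤ y')
    (hcap : y' ≤ stepCaps P v (weight f P x y) y) : IsEfficientGrowth r f P.η x v y y' := by
  have hyc' := feasible_subset_cube hy'
  have hmove' := hP.move_mem_cube hx hyc'
  refine ⟨hy', hyy', le_trans ?_ (hf.sum_grad_le_sub (hP.move_mem_cube hx hy) hmove'
    (move_mono hP.η_nonneg hx.2 hyy'))⟩
  rw [← Finset.sum_sub_distrib, Finset.mul_sum]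
  refine Finset.sum_le_sum fun i _ => ?_
  have hgrad : grad f (lookahead P x y) i ≤ grad f (move P.η x y') i :=
    hf.grad_le_grad hmove' (hP.lookahead_mem_cube hx hy)
      (hP.move_le_lookahead hx (hcap.trans (stepCaps_le_caps hP.τ_nonneg hy.1 _))) i
  have hroom : 0 ≤ 1 - x i := sub_nonneg.2 (hx.2 i)
  have hinc : 0 ≤ y' i - y i := sub_nonneg.2 (hyy' i)
  have hmove : move P.η x y' i - move P.η x y i = P.η * (1 - x i) * (y' i - y i) := by
    simp only [move]
    ring
  rw [hmove]
  by_cases hv : v ≤ weight f P x y i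
  · have hη := hP.η_nonneg
    calc P.η * v * (y' i - y i) ≤ P.η * weight f P x y i * (y' i - y i) := by gcongr
      _ = P.η * (1 - x i) * (y' i - y i) * grad f (lookahead P x y) i := by
        simp only [weight, Pi.mul_apply, Pi.sub_apply, Pi.one_apply]
        ring
      _ ≤ P.η * (1 - x i) * (y' i - y i) * grad f (move P.η x y') i := by gcongr
  · have : y' i = y i := le_antisymm ((hcap i).trans_eq (if_neg hv)) (hyy' i)
    rw [this, sub_self, mul_zero, mul_zero, zero_mul]

theorem step_growth (hf : IsSmoothDR f) (hP : P.IsValid) (hx : x ∈ cube n)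
    (hy : y ∈ feasible r) :
    IsEfficientGrowth r f P.η x v y ((stepAlg r P x v y).result f) := by
  have hyc := feasible_subset_cube hy
  rw [result_stepAlg hP hx hyc]
  have h := isMaximalGrowth_grow hy (le_stepCaps (P := P) (v := v) hP.τ_nonneg hyc.1
    (weight f P x y))
  exact hf.growth_of_le_stepCaps hP hx hyc h.mem h.le h.le_cap

theorem step_eq_caps_or_saturated (hP : P.IsValid) (hx : x ∈ cube n) (hy : y ∈ feasible r)
    (hi : v ≤ weight f P x y i) : (stepAlg r P x v y).result f i = caps P.τ y i ∨
      IsSaturated r ((stepAlg r P x v y).result f) i := by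
  have hyc := feasible_subset_cube hy
  rw [result_stepAlg hP hx hyc]
  have h := (isMaximalGrowth_grow hy (le_stepCaps (P := P) (v := v) hP.τ_nonneg hyc.1
    (weight f P x y))).eq_cap_or_saturated i
  rwa [stepCaps, if_pos hi] at h

theorem level_growth (hf : IsSmoothDR f) (hP : P.IsValid) (hx : x ∈ cube n)
    (hy : y ∈ feasible r) (m : ℕ) :
    IsEfficientGrowth r f P.η x v y ((levelAlg r P x v m y).result f) := by
  induction m with
  | zero => exact .refl hy
  | succ m ih =>
    rw [result_levelAlg_succ]
    exact ih.trans (hf.step_growth hP hx ih.mem)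

theorem level_ge_or_saturated (hf : IsSmoothDR f) (hP : P.IsValid) (hx : x ∈ cube n)
    (hy : y ∈ feasible r) (m : ℕ) (hi : v ≤ weight f P x ((levelAlg r P x v m y).result f) i) :
    ((2 : ℝ) ^ m - 1) * P.τ ≤ (levelAlg r P x v m y).result f i ∨
      IsSaturated r ((levelAlg r P x v m y).result f) i := by
  induction m with
  | zero => exact .inl ((by simp : ((2 : ℝ) ^ 0 - 1) * P.τ = 0).trans_le (hy.1.1 i))
  | succ m ih =>
    rw [result_levelAlg_succ] at hi ⊢
    have hw := (hf.level_growth (v := v) hP hx hy m).mem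
    set w := (levelAlg r P x v m y).result f
    have hstep := hf.step_growth (v := v) hP hx hw
    have hwi : v ≤ weight f P x w i := hi.trans
      (hf.weight_anti hP hx (feasible_subset_cube hw) (feasible_subset_cube hstep.mem) hstep.le i)
    rcases ih hwi with hge | hsat
    · refine (step_eq_caps_or_saturated hP hx hw hwi).imp_left fun heq => ?_
      rw [heq, caps, pow_succ]
      linarith
    · exact .inr (hsat.mono hw.1.1 hstep.le)

theorem level_saturated (hf : IsSmoothDR f) (hP : P.IsValid) (hx : x ∈ cube n)
    (hy : y ∈ feasible r) (hi : v ≤ weight f P x ((levelAlg r P x v P.R y).result f) i) :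
    IsSaturated r ((levelAlg r P x v P.R y).result f) i :=
  (hf.level_ge_or_saturated hP hx hy P.R hi).resolve_left fun h =>
    (hP.one_lt.trans_le h).not_ge ((hf.level_growth hP hx hy P.R).mem.2.2 i)

end IsSmoothDR

/-- The potential of the threshold `v` at `y`, measured against the competitor `z` for the damped
gradient `w`: thresholds below `v` can only collect the excess of `(1 - η) * w` over `v`. While the
threshold decreases, its growth is bounded by the gain of `f`. -/
noncomputable def potential (η v : ℝ) (w y z : Fin n → ℝ) : ℝ :=
  v * ∑ i, y i + ∑ i, max 0 ((1 - η) * w i - v) * z i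

theorem max_zero_sub_le_add_ite {η v w w' : ℝ} (hη0 : 0 ≤ η) (hη1 : η ≤ 1) (hv : 0 ≤ v)
    (hw : w' ≤ w) : max 0 ((1 - η) * w' - (1 - η) * v) ≤
      max 0 ((1 - η) * w - v) + if v ≤ w' then η * v else 0 := by
  have hmax := le_max_left 0 ((1 - η) * w - v)
  have hww' := mul_le_mul_of_nonneg_left hw (sub_nonneg.2 hη1)
  have hηv := mul_nonneg hη0 hv
  split_ifs with h
  · exact max_le (by linarith) (by linarith [le_max_right 0 ((1 - η) * w - v)])
  · exact max_le (by linarith) (by nlinarith)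

theorem sum_le_potential {η : ℝ} {w : Fin n → ℝ} (hv : 0 ≤ v) (hη : η ≤ 1) (hy : 0 ≤ y)
    (hz : 0 ≤ z) : ∑ i, ((1 - η) * max 0 (w i) - v) * z i ≤ potential η v w y z := by
  refine le_add_of_nonneg_of_le (mul_nonneg hv (Finset.sum_nonneg fun i _ => hy i))
    (Finset.sum_le_sum fun i _ => mul_le_mul_of_nonneg_right ?_ (hz i))
  rw [mul_max_of_nonneg _ _ (sub_nonneg.2 hη), mul_zero, sub_le_iff_le_add]
  exact max_le (by linarith [le_max_left 0 ((1 - η) * w i - v)])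
    (by linarith [le_max_right 0 ((1 - η) * w i - v)])

namespace IsSmoothDR

theorem potential_level_le (hf : IsSmoothDR f) (hr : IsPolymatroidRank r) (hP : P.IsValid)
    (hx : x ∈ cube n) (hy : y ∈ feasible r) (hz : z ∈ feasible r) (hv : 0 ≤ v)
    (hy' : y' = (levelAlg r P x v P.R y).result f) :
    P.η * potential P.η ((1 - P.η) * v) (weight f P x y') y' z ≤
      P.η * potential P.η v (weight f P x y) y z + (f (move P.η x y') - f (move P.η x y)) := by
  subst hy'
  have hgrowth := hf.level_growth (v := v) hP hx hy P.R
  have hsat := fun i => hf.level_saturated (v := v) (i := i) hP hx hy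
  set y' := (levelAlg r P x v P.R y).result f
  set w := weight f P x y
  set w' := weight f P x y'
  have hw : ∀ i, w' i ≤ w i := hf.weight_anti hP hx (feasible_subset_cube hy)
    (feasible_subset_cube hgrowth.mem) hgrowth.le
  have hmass : ∑ i with v ≤ w' i, z i ≤ ∑ i, y' i :=
    sum_saturated_le hr hgrowth.mem hz fun i hi => hsat i (Finset.mem_filter.1 hi).2
  have hexcess : ∑ i, max 0 ((1 - P.η) * w' i - (1 - P.η) * v) * z i ≤
      ∑ i, max 0 ((1 - P.η) * w i - v) * z i + P.η * v * ∑ i with v ≤ w' i, z i := by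
    rw [Finset.sum_filter, Finset.mul_sum, ← Finset.sum_add_distrib]
    refine Finset.sum_le_sum fun i _ => ?_
    refine (mul_le_mul_of_nonneg_right (max_zero_sub_le_add_ite hP.η_nonneg
      (by linarith [hP.η_le, hP.η_nonneg]) hv (hw i)) (hz.1.1 i)).trans_eq ?_
    split_ifs <;> ring
  have hmass' := mul_le_mul_of_nonneg_left hmass (mul_nonneg hP.η_nonneg hv)
  have hη := mul_le_mul_of_nonneg_left (hexcess.trans (add_le_add_right hmass' _)) hP.η_nonneg
  unfold potential
  linarith [hgrowth.gain]

theorem weight_zero_le (hf : IsSmoothDR f) (hP : P.IsValid) (hx : x ∈ cube n)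
    (hG : ∀ i, grad f 0 i ≤ P.G) (i : Fin n) : weight f P x 0 i ≤ P.G := by
  have hroom : 0 ≤ 1 - x i ∧ 1 - x i ≤ 1 :=
    ⟨sub_nonneg.2 (hx.2 i), sub_le_self _ (hx.1 i)⟩
  have hmem := hP.lookahead_mem_cube hx zero_mem_cube
  calc (1 - x i) * grad f (lookahead P x 0) i ≤ (1 - x i) * P.G :=
        mul_le_mul_of_nonneg_left ((hf.grad_le_grad zero_mem_cube hmem hmem.1 i).trans (hG i))
          hroom.1
    _ ≤ P.G := mul_le_of_le_one_left hP.G_nonneg hroom.2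

theorem direction_mem (hf : IsSmoothDR f) (hr : IsPolymatroidRank r) (hP : P.IsValid)
    (hx : x ∈ cube n) (j : ℕ) : (directionAlg r P x j).result f ∈ feasible r := by
  induction j with
  | zero => exact zero_mem_feasible hr
  | succ j ih =>
    rw [result_directionAlg_succ]
    exact (hf.level_growth hP hx ih P.R).mem

theorem direction_potential (hf : IsSmoothDR f) (hr : IsPolymatroidRank r) (hP : P.IsValid)
    (hx : x ∈ cube n) (hG : ∀ i, grad f 0 i ≤ P.G) (hz : z ∈ feasible r) (j : ℕ)
    (hy : y = (directionAlg r P x j).result f) :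
    P.η * potential P.η (P.threshold j) (weight f P x y) y z ≤ f (move P.η x y) - f x := by
  induction j generalizing y with
  | zero =>
    obtain rfl : y = 0 := hy
    have hexcess : ∀ i, max 0 ((1 - P.η) * weight f P x 0 i - P.threshold 0) = 0 := fun i => by
      have hw := mul_le_mul_of_nonneg_left (hf.weight_zero_le hP hx hG i)
        (show 0 ≤ 1 - P.η by linarith [hP.η_le, hP.η_nonneg])
      rw [Params.threshold, pow_zero, mul_one]
      exact max_eq_left (by linarith [mul_nonneg hP.η_nonneg hP.G_nonneg])
    simp only [potential, hexcess, Pi.zero_apply, Finset.sum_const_zero, mul_zero, zero_mul,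
      add_zero, move_zero, sub_self, le_refl]
  | succ j ih =>
    rw [result_directionAlg_succ] at hy
    have hlevel := hf.potential_level_le hr hP hx (hf.direction_mem hr hP hx j) hz
      (hP.threshold_nonneg j) hy
    rw [show (1 - P.η) * P.threshold j = P.threshold (j + 1) by
      simp only [Params.threshold, pow_succ]; ring] at hlevel
    linarith [ih rfl]

theorem direction_gain (hf : IsSmoothDR f) (hr : IsPolymatroidRank r) (hP : P.IsValid)
    (hx : x ∈ cube n) (hG : ∀ i, grad f 0 i ≤ P.G) (hz : z ∈ feasible r) (j : ℕ)
    (hy : y = (directionAlg r P x j).result f) :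
    P.η * ∑ i, ((1 - P.η) * max 0 (weight f P x y i) - P.threshold j) * z i ≤
      f (move P.η x y) - f x := by
  have hmem : y ∈ feasible r := hy ▸ hf.direction_mem hr hP hx j
  exact (mul_le_mul_of_nonneg_left (sum_le_potential (hP.threshold_nonneg j)
    (by linarith [hP.η_le, hP.η_nonneg]) hmem.1.1 hz.1.1) hP.η_nonneg).trans
    (hf.direction_potential hr hP hx hG hz j hy)

end IsSmoothDR

end Direction

section Phase

variable {f : (Fin n → ℝ) → ℝ} {r : Finset (Fin n) → ℝ} {x y z : Fin n → ℝ} {P : Params}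

namespace IsSmoothDR

theorem value_move_two_smul_le (hf : IsSmoothDR f) {η : ℝ} (hη : 0 ≤ η) (hx : x ∈ cube n)
    (hy : 0 ≤ y) (hmem : move η x ((2 : ℝ) • y) ∈ cube n) :
    f (move η x ((2 : ℝ) • y)) ≤ 2 * f (move η x y) - f x := by
  have hle : x ≤ move η x ((2 : ℝ) • y) :=
    (move_zero η x).symm.le.trans (move_mono hη hx.2 (smul_nonneg zero_le_two hy))
  have hmid : x + (1 / 2 : ℝ) • (move η x ((2 : ℝ) • y) - x) = move η x y := by
    ext i
    simp only [move, Pi.add_apply, Pi.smul_apply, Pi.sub_apply, smul_eq_mul]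
    ring
  have hconc := hf.concave_of_le hx hmem hle (t := 1 / 2) (by norm_num)
  rw [hmid] at hconc
  linarith

theorem value_lookahead_le (hf : IsSmoothDR f) (hP : P.IsValid) (hx : x ∈ cube n)
    (hy : y ∈ cube n) (hG : ∀ i, grad f 0 i ≤ P.G) :
    f (lookahead P x y) ≤ 2 * f (move P.η x y) - f x + P.η * (n * (P.τ * P.G)) := by
  have hη := hP.η_nonneg
  have hcaps : (2 : ℝ) • y ≤ caps P.τ y := fun i => le_add_of_nonneg_right hP.τ_nonneg
  have hmem : move P.η x ((2 : ℝ) • y) ∈ cube n := by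
    refine move_mem_cube hη (b := 2) (by linarith [hP.η_le]) hx (smul_nonneg zero_le_two hy.1)
      fun i => ?_
    change 2 * y i ≤ 2
    linarith [(mem_cube_iff.1 hy i).2]
  have hlook := hf.sub_le_sum_grad hmem (hP.lookahead_mem_cube hx hy)
    (move_mono hη hx.2 hcaps)
  have hoffset : ∀ i, (lookahead P x y i - move P.η x ((2 : ℝ) • y) i) *
      grad f (move P.η x ((2 : ℝ) • y)) i ≤ P.η * (P.τ * P.G) := fun i => by
    have hgrad := (hf.grad_le_grad zero_mem_cube hmem hmem.1 i).trans (hG i)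
    have hxi := mem_cube_iff.1 hx i
    have hητ := mul_nonneg hη hP.τ_nonneg
    calc _ = P.η * P.τ * (1 - x i) * grad f (move P.η x ((2 : ℝ) • y)) i := by
          simp only [lookahead, move, caps, Pi.smul_apply, smul_eq_mul]
          ring
      _ ≤ P.η * P.τ * (1 - x i) * P.G :=
          mul_le_mul_of_nonneg_left hgrad (mul_nonneg hητ (sub_nonneg.2 hxi.2))
      _ ≤ P.η * P.τ * 1 * P.G := by
          have := hP.G_nonneg
          gcongr
          linarith
      _ = P.η * (P.τ * P.G) := by ring
  have hsum := Finset.sum_le_card_nsmul Finset.univ _ _ fun i _ => hoffset i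
  rw [Finset.card_univ, Fintype.card_fin, nsmul_eq_mul] at hsum
  linarith [hf.value_move_two_smul_le hη hx hy.1 hmem]

theorem sup_sub_le_sum_weight (hf : IsSmoothDR f) (hP : P.IsValid) (hx : x ∈ cube n)
    (hy : y ∈ cube n) (hz : z ∈ cube n) :
    f (lookahead P x y ⊔ z) - f (lookahead P x y) ≤ ∑ i, max 0 (weight f P x y i) * z i := by
  have hmem := hP.lookahead_mem_cube hx hy
  have hxw := hP.le_lookahead hx hy
  refine (hf.sub_le_sum_grad hmem ⟨hmem.1.trans le_sup_left, sup_le hmem.2 hz.2⟩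
    le_sup_left).trans (Finset.sum_le_sum fun i _ => ?_)
  change _ ≤ max 0 ((1 - x i) * grad f (lookahead P x y) i) * z i
  set w := lookahead P x y
  have hroom : 0 ≤ 1 - x i := sub_nonneg.2 (hx.2 i)
  have hzi := mem_cube_iff.1 hz i
  have hinc0 : 0 ≤ (w ⊔ z) i - w i := sub_nonneg.2 (le_sup_left (a := w i))
  have hinc : (w ⊔ z) i - w i ≤ (1 - x i) * z i := by
    refine sub_le_iff_le_add.2 (sup_le ?_ ?_)
    · linarith [mul_nonneg hroom hzi.1]
    · linarith [hxw i, mul_le_of_le_one_right (mem_cube_iff.1 hx i).1 hzi.2]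
  calc ((w ⊔ z) i - w i) * grad f w i ≤ ((w ⊔ z) i - w i) * max 0 (grad f w i) :=
        mul_le_mul_of_nonneg_left (le_max_right _ _) hinc0
    _ ≤ (1 - x i) * z i * max 0 (grad f w i) :=
        mul_le_mul_of_nonneg_right hinc (le_max_left _ _)
    _ = max 0 ((1 - x i) * grad f w i) * z i := by
        rw [← mul_zero (1 - x i), ← mul_max_of_nonneg _ _ hroom, mul_zero]
        ring

end IsSmoothDR

theorem Params.IsValid.mul_le_one_sub_lookahead (hP : P.IsValid) (hx : x ∈ cube n)
    (hy : y ∈ cube n) (i : Fin n) :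
    (1 - 3 * P.η) * (1 - x i) ≤ 1 - lookahead P x y i := by
  have hroom := mul_nonneg hP.η_nonneg (sub_nonneg.2 (mem_cube_iff.1 hx i).2)
  have hcap : P.η * (1 - x i) * (2 * y i + P.τ) ≤ P.η * (1 - x i) * 3 :=
    mul_le_mul_of_nonneg_left (by linarith [hP.τ_le, (mem_cube_iff.1 hy i).2]) hroom
  simp only [lookahead, move, caps]
  linarith

/-- Parameters for which the accumulated errors of the algorithm on `f` are small compared with a
reference value `O`, the optimum in the application: `G` bounds the gradient, and both the offset
`τ` and the last threshold are negligible. -/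
structure IsTuned (P : Params) (f : (Fin n → ℝ) → ℝ) (O : ℝ) : Prop extends P.IsValid where
  grad_le : ∀ i, grad f 0 i ≤ P.G
  growth_le : n * (P.τ * P.G) ≤ P.η * O
  threshold_le : n * P.threshold P.J ≤ P.η * O

namespace IsTuned

theorem phase_gain (ht : IsTuned P f (f z)) (hf : IsSmoothDR f) (hr : IsPolymatroidRank r)
    (hz : z ∈ feasible r) (hx : x ∈ cube n) (hy : y = (directionAlg r P x P.J).result f) :
    P.η * ((1 - P.η) * (f (lookahead P x y ⊔ z) - f (lookahead P x y)) - P.η * f z) ≤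
      f (move P.η x y) - f x := by
  have hP := ht.toIsValid
  have hη1 : 0 ≤ 1 - P.η := by linarith [hP.η_le, hP.η_nonneg]
  have hyc : y ∈ cube n := feasible_subset_cube (hy ▸ hf.direction_mem hr hP hx P.J)
  have hzc := feasible_subset_cube hz
  refine le_trans (mul_le_mul_of_nonneg_left ?_ hP.η_nonneg)
    (hf.direction_gain hr hP hx ht.grad_le hz P.J hy)
  have hthreshold : ∑ i, P.threshold P.J * z i ≤ P.η * f z := by
    refine le_trans ?_ ht.threshold_le
    refine (Finset.sum_le_card_nsmul Finset.univ _ _ fun i _ =>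
      mul_le_of_le_one_right (hP.threshold_nonneg P.J) (hzc.2 i)).trans_eq ?_
    rw [Finset.card_univ, Fintype.card_fin, nsmul_eq_mul]
  calc _ ≤ (1 - P.η) * ∑ i, max 0 (weight f P x y i) * z i - ∑ i, P.threshold P.J * z i :=
        sub_le_sub (mul_le_mul_of_nonneg_left (hf.sup_sub_le_sum_weight hP hx hyc hzc) hη1)
          hthreshold
    _ = _ := by
        rw [Finset.mul_sum, ← Finset.sum_sub_distrib]
        exact Finset.sum_congr rfl fun i _ => by ring

theorem phase_recurrence (ht : IsTuned P f (f z)) (hf : IsSmoothDR f)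
    (hf0 : ∀ x ∈ cube n, 0 ≤ f x) (hr : IsPolymatroidRank r) (hz : z ∈ feasible r)
    (hx : x ∈ cube n) (hy : y = (directionAlg r P x P.J).result f) {β : ℝ} (hβ : β ∈ Set.Icc 0 1)
    (hsup : (1 - 3 * P.η) * β * f z ≤ f (lookahead P x y ⊔ z)) :
    (1 + P.η) * f x + P.η * (β - 6 * P.η) * f z ≤ (1 + 2 * P.η) * f (move P.η x y) := by
  have hP := ht.toIsValid
  have hη := hP.η_nonneg
  have hη6 := hP.η_le
  have hyc : y ∈ cube n := feasible_subset_cube (hy ▸ hf.direction_mem hr hP hx P.J)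
  have hO := hf0 z (feasible_subset_cube hz)
  have hgain := ht.phase_gain hf hr hz hx hy
  set O := f z
  set w := f (lookahead P x y)
  set b := f (move P.η x y)
  have hw0 : 0 ≤ w := hf0 _ (hP.lookahead_mem_cube hx hyc)
  have hw : w ≤ 2 * b - f x + P.η * (P.η * O) := (hf.value_lookahead_le hP hx hyc ht.grad_le).trans
    (add_le_add_right (mul_le_mul_of_nonneg_left ht.growth_le hη) _)
  have hB : (β - 4 * P.η) * O ≤ (1 - P.η) * f (lookahead P x y ⊔ z) := by
    refine le_trans ?_ (mul_le_mul_of_nonneg_left hsup (by linarith))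
    nlinarith [mul_nonneg hη hO, mul_nonneg (mul_nonneg hη hO) (sub_nonneg.2 hβ.2),
      mul_nonneg (mul_nonneg hη hη) (mul_nonneg hβ.1 hO)]
  have hloss : P.η * (P.η * O) ≤ P.η * O := mul_le_of_le_one_left (mul_nonneg hη hO) (by linarith)
  have hbound : (β - 4 * P.η) * O - (2 * b - f x + P.η * (P.η * O)) - P.η * O ≤
      (1 - P.η) * (f (lookahead P x y ⊔ z) - w) - P.η * O := by
    nlinarith [mul_nonneg hη hw0]
  nlinarith [mul_le_mul_of_nonneg_left hbound hη, mul_le_mul_of_nonneg_left hloss hη]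

end IsTuned

end Phase

section GreedyGuarantee

theorem exp_neg_one_le_one_sub_pow {N : ℕ} {η : ℝ} (hη : ((N : ℝ) + 1) * η = 1) :
    Real.exp (-1) ≤ (1 - η) ^ N := by
  rcases N.eq_zero_or_pos with rfl | hN
  · simp
  have hN0 : (0 : ℝ) < N := Nat.cast_pos.2 hN
  have hsub : 1 - η = N / (N + 1) := by
    field_simp
    linarith
  have hpos : 0 < 1 - η := hsub ▸ by positivity
  rw [← Real.le_log_iff_exp_le (pow_pos hpos N), Real.log_pow]
  calc (-1 : ℝ) = N * (1 - (1 - η)⁻¹) := by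
        rw [hsub]
        field_simp
        ring
    _ ≤ N * Real.log (1 - η) :=
        mul_le_mul_of_nonneg_left (Real.one_sub_inv_le_log_of_pos hpos) hN0.le

theorem general_value_bound {a : ℕ → ℝ} {η O : ℝ} {N : ℕ} (hη0 : 0 ≤ η) (hη : 6 * η ≤ 1)
    (hO : 0 ≤ O) (hN : ((N : ℝ) + 1) * η = 1) (ha0 : ∀ j, 0 ≤ a j)
    (ha : ∀ j, (1 + η) * a j + η * ((1 - η) ^ j - 6 * η) * O ≤ (1 + 2 * η) * a (j + 1)) :
    (1 / Real.exp 1 - 8 * η) * O ≤ a (N + 1) := by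
  have hsum : ∀ j : ℕ,
      ((j : ℝ) + 1) * η * ((1 - η) ^ j - 6 * η) * O ≤ (1 + 2 * η) * a (j + 1) := fun j => by
    induction j with
    | zero =>
      have h := ha 0
      simp only [pow_zero, Nat.cast_zero, zero_add, one_mul] at h ⊢
      linarith [mul_nonneg (show 0 ≤ 1 + η by linarith) (ha0 0)]
    | succ j ih =>
      have hstep : (1 - η) * ((1 + 2 * η) * a (j + 1)) ≤ (1 + η) * a (j + 1) := by
        nlinarith [ha0 (j + 1), mul_nonneg (mul_nonneg hη0 hη0) (ha0 (j + 1))]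
      have hih := (mul_le_mul_of_nonneg_left ih (show 0 ≤ 1 - η by linarith)).trans hstep
      have hextra : 0 ≤ ((j : ℝ) + 1) * η * (6 * η * η) * O := by positivity
      have hrec := ha (j + 1)
      push_cast
      rw [pow_succ] at hrec ⊢
      linarith
  have hlast := hsum N
  rw [hN, one_mul] at hlast
  have hexp : 1 / Real.exp 1 ≤ (1 - η) ^ N := by
    rw [one_div, ← Real.exp_neg]
    exact exp_neg_one_le_one_sub_pow hN
  have hexp1 : 1 / Real.exp 1 ≤ 1 :=
    (div_le_one (Real.exp_pos 1)).2 (Real.one_le_exp zero_le_one)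
  set e := 1 / Real.exp 1
  have hcoef : (e - 8 * η) * (1 + 2 * η) ≤ (1 - η) ^ N - 6 * η := by nlinarith
  have hscaled := mul_le_mul_of_nonneg_right hcoef hO
  exact le_of_mul_le_mul_left (a := 1 + 2 * η) (by linarith) (by linarith)

theorem one_add_div_pow_le {η : ℝ} {N : ℕ} (hη0 : 0 ≤ η) (hη : 2 * η ≤ 1) (hN : (N : ℝ) * η = 1) :
    ((1 + η) / (1 + 2 * η)) ^ N ≤ 1 / Real.exp 1 * (1 + 4 * η) := by
  have hbase : (1 + η) / (1 + 2 * η) ≤ Real.exp (-η + 2 * η ^ 2) := by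
    refine le_trans ?_ (Real.add_one_le_exp _)
    rw [div_le_iff₀ (by linarith)]
    nlinarith [pow_nonneg hη0 3]
  have hexp : Real.exp (2 * η) ≤ 1 + 4 * η := by
    have habs := (abs_le.1 (Real.abs_exp_sub_one_le (x := 2 * η)
      (by rwa [abs_of_nonneg (by linarith)]))).2
    rw [abs_of_nonneg (show 0 ≤ 2 * η by linarith)] at habs
    linarith
  calc ((1 + η) / (1 + 2 * η)) ^ N ≤ Real.exp (-η + 2 * η ^ 2) ^ N := by gcongr
    _ = Real.exp (-1) * Real.exp (2 * η) := by
        rw [← Real.exp_nat_mul, ← Real.exp_add]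
        congr 1
        linear_combination (2 * η - 1) * hN
    _ ≤ 1 / Real.exp 1 * (1 + 4 * η) := by
        rw [Real.exp_neg, one_div]
        gcongr

theorem monotone_value_bound {a : ℕ → ℝ} {η O : ℝ} {N : ℕ} (hη0 : 0 ≤ η) (hη : 6 * η ≤ 1)
    (hO : 0 ≤ O) (hN : (N : ℝ) * η = 1) (ha0 : 0 ≤ a 0)
    (ha : ∀ j, (1 + η) * a j + η * (1 - 6 * η) * O ≤ (1 + 2 * η) * a (j + 1)) :
    (1 - 1 / Real.exp 1 - 8 * η) * O ≤ a N := by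
  have hpos : 0 < 1 + 2 * η := by linarith
  set q := (1 + η) / (1 + 2 * η) with hq
  have hO' : 0 ≤ (1 - 6 * η) * O := mul_nonneg (by linarith) hO
  have hgap : ∀ j : ℕ, (1 - 6 * η) * O - a j ≤ q ^ j * ((1 - 6 * η) * O) := fun j => by
    induction j with
    | zero => simpa using ha0
    | succ j ih =>
      have hstep : (1 - 6 * η) * O - a (j + 1) ≤ q * ((1 - 6 * η) * O - a j) := by
        rw [hq, div_mul_eq_mul_div, le_div_iff₀ hpos]
        linarith [ha j]
      rw [pow_succ', mul_assoc]
      exact hstep.trans (mul_le_mul_of_nonneg_left ih (by positivity))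
  have hpow := mul_le_mul_of_nonneg_right
    (one_add_div_pow_le hη0 (by linarith) hN) hO'
  have he0 : 0 ≤ 1 / Real.exp 1 := by positivity
  set e := 1 / Real.exp 1
  have hcoef : 1 - e - 8 * η ≤ (1 - e * (1 + 4 * η)) * (1 - 6 * η) := by
    nlinarith [mul_nonneg he0 hη0, mul_nonneg (mul_nonneg he0 hη0) hη0]
  linarith [hgap N, mul_le_mul_of_nonneg_right hcoef hO]

variable {f : (Fin n → ℝ) → ℝ} {r : Finset (Fin n) → ℝ} {z : Fin n → ℝ} {P : Params}

namespace IsSmoothDR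

theorem greedy_mem_cube (hf : IsSmoothDR f) (hr : IsPolymatroidRank r) (hP : P.IsValid) (N : ℕ) :
    (greedyAlg r P N).result f ∈ cube n := by
  induction N with
  | zero => exact zero_mem_cube
  | succ N ih =>
    rw [result_greedyAlg_succ]
    exact hP.move_mem_cube ih (feasible_subset_cube (hf.direction_mem hr hP ih P.J))

theorem sum_greedy_le (hf : IsSmoothDR f) (hr : IsPolymatroidRank r) (hP : P.IsValid) (N : ℕ)
    (S : Finset (Fin n)) : ∑ i ∈ S, (greedyAlg r P N).result f i ≤ N * P.η * r S := by
  induction N with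
  | zero =>
    change ∑ _i ∈ S, (0 : ℝ) ≤ _
    rw [Finset.sum_const_zero, Nat.cast_zero, zero_mul, zero_mul]
  | succ N ih =>
    have hx := hf.greedy_mem_cube hr hP N
    rw [result_greedyAlg_succ]
    set x := (greedyAlg r P N).result f
    have hy := hf.direction_mem hr hP hx P.J
    set y := (directionAlg r P x P.J).result f
    have hmove : ∀ i, move P.η x y i ≤ x i + P.η * y i := fun i => by
      have := mul_nonneg (mul_nonneg hP.η_nonneg (hx.1 i)) (hy.1.1 i)
      simp only [move]
      linarith
    calc ∑ i ∈ S, move P.η x y i ≤ ∑ i ∈ S, (x i + P.η * y i) :=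
          Finset.sum_le_sum fun i _ => hmove i
      _ = ∑ i ∈ S, x i + P.η * ∑ i ∈ S, y i := by rw [Finset.sum_add_distrib, Finset.mul_sum]
      _ ≤ N * P.η * r S + P.η * r S :=
          add_le_add ih (mul_le_mul_of_nonneg_left (hy.1.2 S) hP.η_nonneg)
      _ = (N + 1 : ℕ) * P.η * r S := by
          push_cast
          ring

theorem pow_le_one_sub_greedy (hf : IsSmoothDR f) (hr : IsPolymatroidRank r) (hP : P.IsValid)
    (N : ℕ) (i : Fin n) : (1 - P.η) ^ N ≤ 1 - (greedyAlg r P N).result f i := by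
  induction N with
  | zero => exact (pow_zero _).le.trans (sub_zero _).symm.le
  | succ N ih =>
    have hx := hf.greedy_mem_cube hr hP N
    rw [result_greedyAlg_succ]
    set x := (greedyAlg r P N).result f
    have hy := feasible_subset_cube (hf.direction_mem hr hP hx P.J)
    have hstep := mul_le_mul_of_nonneg_left (mem_cube_iff.1 hy i).2
      (mul_nonneg hP.η_nonneg (sub_nonneg.2 (mem_cube_iff.1 hx i).2))
    have hih := mul_le_mul_of_nonneg_right ih
      (show 0 ≤ 1 - P.η by linarith [hP.η_le, hP.η_nonneg])
    rw [pow_succ, move]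
    linarith

theorem greedy_mem_feasible (hf : IsSmoothDR f) (hr : IsPolymatroidRank r) (hP : P.IsValid)
    {N : ℕ} (hN : N * P.η ≤ 1) : (greedyAlg r P N).result f ∈ feasible r :=
  have hmem := hf.greedy_mem_cube hr hP N
  ⟨⟨hmem.1, fun S => (hf.sum_greedy_le hr hP N S).trans
    (mul_le_of_le_one_left (hr.nonneg S) hN)⟩, hmem⟩

end IsSmoothDR

namespace IsTuned

theorem greedy_value_general (ht : IsTuned P f (f z)) (hf : IsSmoothDR f)
    (hf0 : ∀ x ∈ cube n, 0 ≤ f x) (hr : IsPolymatroidRank r) (hz : z ∈ feasible r) {N : ℕ}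
    (hN : N * P.η = 1) :
    (1 / Real.exp 1 - 8 * P.η) * f z ≤ f ((greedyAlg r P N).result f) := by
  have hP := ht.toIsValid
  have hη := hP.η_nonneg
  have hη6 := hP.η_le
  have hzc := feasible_subset_cube hz
  have hmem := hf.greedy_mem_cube hr hP
  obtain ⟨M, rfl⟩ : ∃ M, N = M + 1 := Nat.exists_eq_succ_of_ne_zero (by
    rintro rfl
    simp at hN)
  refine general_value_bound (a := fun j => f ((greedyAlg r P j).result f)) hη hη6
    (hf0 _ hzc) (by exact_mod_cast hN) (fun j => hf0 _ (hmem j)) fun j => ?_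
  have hyc := feasible_subset_cube (hf.direction_mem hr hP (hmem j) P.J)
  have hβ : (1 - P.η) ^ j ∈ Set.Icc (0 : ℝ) 1 :=
    ⟨pow_nonneg (by linarith) j, pow_le_one₀ (by linarith) (by linarith)⟩
  rw [result_greedyAlg_succ]
  refine ht.phase_recurrence hf hf0 hr hz (hmem j) rfl hβ ?_
  have hroom : ∀ i, lookahead P ((greedyAlg r P j).result f)
      ((directionAlg r P ((greedyAlg r P j).result f) P.J).result f) i ≤
        1 - (1 - 3 * P.η) * (1 - P.η) ^ j := fun i => by
    have := mul_le_mul_of_nonneg_left (hf.pow_le_one_sub_greedy hr hP j i)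
      (show 0 ≤ 1 - 3 * P.η by linarith)
    linarith [hP.mul_le_one_sub_lookahead (hmem j) hyc i]
  have hprod : (1 - 3 * P.η) * (1 - P.η) ^ j ∈ Set.Icc (0 : ℝ) 1 :=
    ⟨mul_nonneg (by linarith) hβ.1, mul_le_one₀ (by linarith) hβ.1 hβ.2⟩
  simpa only [sub_sub_cancel] using
    hf.mul_le_sup hf0 hzc (sub_nonneg.2 hprod.2) (sub_le_self _ hprod.1) hroom

theorem greedy_value_monotone (ht : IsTuned P f (f z)) (hf : IsSmoothDR f)
    (hf0 : ∀ x ∈ cube n, 0 ≤ f x) (hr : IsPolymatroidRank r) (hz : z ∈ feasible r) {N : ℕ}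
    (hN : N * P.η = 1) (hmono : MonotoneOn f (cube n)) :
    (1 - 1 / Real.exp 1 - 8 * P.η) * f z ≤ f ((greedyAlg r P N).result f) := by
  have hP := ht.toIsValid
  have hzc := feasible_subset_cube hz
  have hmem := hf.greedy_mem_cube hr hP
  refine monotone_value_bound (a := fun j => f ((greedyAlg r P j).result f)) hP.η_nonneg hP.η_le
    (hf0 _ hzc) hN (hf0 _ (hmem 0)) fun j => ?_
  have hw := hP.lookahead_mem_cube (hmem j)
    (feasible_subset_cube (hf.direction_mem hr hP (hmem j) P.J))
  rw [result_greedyAlg_succ]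
  refine ht.phase_recurrence hf hf0 hr hz (hmem j) rfl ⟨zero_le_one, le_rfl⟩ ?_
  refine le_trans ?_ (hmono hzc ⟨hw.1.trans le_sup_left, sup_le hw.2 hzc.2⟩ le_sup_right)
  exact mul_le_of_le_one_left (hf0 _ hzc) (by linarith [hP.η_nonneg])

end IsTuned

end GreedyGuarantee

section Multilinear

variable {r : Finset (Fin n) → ℝ} {g : Finset (Fin n) → ℝ} {x : Fin n → ℝ} {i : Fin n}
  {S : Finset (Fin n)}

/-- The probability that `S` is the set obtained by choosing every element `j ≠ i` independently
with probability `x j`. -/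
def setWeight (x : Fin n → ℝ) (i : Fin n) (S : Finset (Fin n)) : ℝ :=
  (∏ j ∈ S, x j) * ∏ j ∈ Sᶜ.erase i, (1 - x j)

theorem setWeight_nonneg (hx : x ∈ cube n) (i : Fin n) (S : Finset (Fin n)) :
    0 ≤ setWeight x i S :=
  mul_nonneg (Finset.prod_nonneg fun j _ => hx.1 j)
    (Finset.prod_nonneg fun j _ => sub_nonneg.2 (hx.2 j))

theorem sum_setWeight (x : Fin n → ℝ) (i : Fin n) :
    ∑ S ∈ (Finset.univ.erase i).powerset, setWeight x i S = 1 := by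
  simp only [setWeight, Finset.compl_eq_univ_sdiff, ← Finset.erase_sdiff_comm]
  rw [← Finset.prod_add]
  simp only [add_sub_cancel, Finset.prod_const_one]

theorem setWeight_update (hS : i ∉ S) (x : Fin n → ℝ) (t : ℝ) :
    setWeight (Function.update x i t) i S = setWeight x i S := by
  rw [setWeight, Finset.prod_update_of_notMem hS]
  congr 1
  exact Finset.prod_congr rfl fun j hj => by
    rw [Function.update_of_ne (Finset.ne_of_mem_erase hj)]

theorem multilinearExt_eq_sum_setWeight (g : Finset (Fin n) → ℝ) (x : Fin n → ℝ) (i : Fin n) :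
    multilinearExt g x = ∑ S ∈ (Finset.univ.erase i).powerset,
      ((1 - x i) * g S + x i * g (insert i S)) * setWeight x i S := by
  have huniv : (Finset.univ : Finset (Finset (Fin n))) =
      (insert i (Finset.univ.erase i)).powerset := by
    rw [Finset.insert_erase (Finset.mem_univ i), Finset.powerset_univ]
  rw [multilinearExt, huniv, Finset.sum_powerset_insert (Finset.notMem_erase i _),
    ← Finset.sum_add_distrib]
  refine Finset.sum_congr rfl fun S hS => ?_
  have hi : i ∉ S := fun h => Finset.notMem_erase i _ (Finset.mem_powerset.1 hS h)
  rw [Finset.prod_insert hi, Finset.compl_insert, setWeight,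
    ← Finset.mul_prod_erase _ _ (Finset.mem_compl.2 hi)]
  ring

theorem multilinearExt_update (g : Finset (Fin n) → ℝ) (x : Fin n → ℝ) (i : Fin n) (t : ℝ) :
    multilinearExt g (Function.update x i t) = ∑ S ∈ (Finset.univ.erase i).powerset,
      ((1 - t) * g S + t * g (insert i S)) * setWeight x i S := by
  rw [multilinearExt_eq_sum_setWeight g _ i, Function.update_self]
  exact Finset.sum_congr rfl fun S hS => by
    rw [setWeight_update fun h => Finset.notMem_erase i _ (Finset.mem_powerset.1 hS h)]

theorem grad_multilinearExt (g : Finset (Fin n) → ℝ) (hx : x ∈ cube n) (i : Fin n) :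
    grad (multilinearExt g) x i =
      ∑ S ∈ (Finset.univ.erase i).powerset, (g (insert i S) - g S) * setWeight x i S := by
  have hdiff : Differentiable ℝ (multilinearExt g) := by
    unfold multilinearExt
    fun_prop
  have hxi : x i ∈ Set.Icc (0 : ℝ) 1 := mem_cube_iff.1 hx i
  have hgrad := hasDerivWithinAt_update (i := i) hdiff.differentiableOn hx hxi
  rw [Function.update_eq_self] at hgrad
  refine (uniqueDiffOn_Icc zero_lt_one (x i) hxi).eq_deriv _ hgrad ?_
  simp only [multilinearExt_update]
  refine (HasDerivAt.fun_sum fun S _ => ?_).hasDerivWithinAt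
  have hlin : HasDerivAt (fun t : ℝ => (1 - t) * g S + t * g (insert i S))
      (-1 * g S + 1 * g (insert i S)) (x i) :=
    (((hasDerivAt_id (x i)).const_sub 1).mul_const _).add ((hasDerivAt_id (x i)).mul_const _)
  rw [neg_one_mul, one_mul, neg_add_eq_sub] at hlin
  exact hlin.mul_const _

theorem multilinearExt_single (g : Finset (Fin n) → ℝ) (i : Fin n) :
    multilinearExt g (Pi.single i 1) = g {i} := by
  rw [Pi.single, multilinearExt_update,
    Finset.sum_eq_single_of_mem ∅ (Finset.empty_mem_powerset _) fun S _ hS => ?_]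
  · simp [setWeight]
  · obtain ⟨j, hj⟩ := Finset.nonempty_iff_ne_empty.2 hS
    rw [setWeight, Finset.prod_eq_zero hj rfl, zero_mul, mul_zero]

theorem single_mem_feasible (hr : IsPolymatroidRank r) (hi : 1 ≤ r {i}) :
    Pi.single i 1 ∈ feasible r := by
  refine mem_feasible_iff.2 ⟨Pi.single_nonneg.2 zero_le_one, fun j => ?_, fun S => ?_⟩
  · rcases eq_or_ne j i with rfl | hj <;> simp [*]
  · rw [Finset.sum_pi_single']
    split_ifs with hS
    exacts [hi.trans (hr.mono _ _ (Finset.singleton_subset_iff.2 hS)), hr.nonneg S]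

theorem grad_multilinearExt_le (hg0 : 0 ≤ g ∅) (hg : IsSubmodular g) (hx : x ∈ cube n)
    (i : Fin n) : grad (multilinearExt g) x i ≤ g {i} := by
  rw [grad_multilinearExt g hx]
  calc ∑ S ∈ (Finset.univ.erase i).powerset, (g (insert i S) - g S) * setWeight x i S
      ≤ ∑ S ∈ (Finset.univ.erase i).powerset, g {i} * setWeight x i S := by
        refine Finset.sum_le_sum fun S hS => ?_
        have hmarginal := hg ∅ S (Finset.empty_subset S) i fun h =>
          Finset.notMem_erase i _ (Finset.mem_powerset.1 hS h)
        rw [insert_empty_eq] at hmarginal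
        exact mul_le_mul_of_nonneg_right (by linarith) (setWeight_nonneg hx i S)
    _ = g {i} := by rw [← Finset.mul_sum, sum_setWeight, mul_one]

end Multilinear

section Adaptive

variable {f : (Fin n → ℝ) → ℝ} {r : Finset (Fin n) → ℝ} {z : Fin n → ℝ} {N : ℕ} {v κ O : ℝ}

/-- A feasible point whose value determines the optimum up to a factor `2 * n`: it dominates
`z / n` for every feasible `z`, but no coordinate exceeds `1 / n`. -/
noncomputable def probe (r : Finset (Fin n) → ℝ) : Fin n → ℝ := fun i => min 1 (r {i}) / n

theorem probe_mem_feasible (hr : IsPolymatroidRank r) : probe r ∈ feasible r := by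
  refine mem_feasible_iff.2 ⟨fun i => ?_, fun i => ?_, fun S => ?_⟩
  · exact div_nonneg (le_min zero_le_one (hr.nonneg {i})) n.cast_nonneg
  · exact div_le_one_of_le₀ ((min_le_left _ _).trans (Nat.one_le_cast.2 i.pos)) n.cast_nonneg
  · calc ∑ i ∈ S, probe r i ≤ S.card • (r S / n) :=
          Finset.sum_le_card_nsmul _ _ _ fun i hi => div_le_div_of_nonneg_right
            ((min_le_right _ _).trans (hr.mono _ _ (Finset.singleton_subset_iff.2 hi)))
            n.cast_nonneg
      _ = S.card / n * r S := by
          rw [nsmul_eq_mul]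
          ring
      _ ≤ r S := mul_le_of_le_one_left (hr.nonneg S) (div_le_one_of_le₀
          (Nat.cast_le.2 (card_finset_fin_le S)) n.cast_nonneg)

theorem IsSmoothDR.le_value_probe (hf : IsSmoothDR f) (hf0 : ∀ x ∈ cube n, 0 ≤ f x)
    (hn : 2 ≤ n) (hz : z ∈ feasible r) : f z ≤ 2 * n * f (probe r) := by
  have hn2 : (2 : ℝ) ≤ n := Nat.ofNat_le_cast.2 hn
  have hinv : ((n : ℝ)⁻¹) ∈ Set.Icc (0 : ℝ) 1 :=
    ⟨by positivity, inv_le_one_of_one_le₀ (by linarith)⟩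
  have hzn : (n : ℝ)⁻¹ • z ∈ cube n := feasible_subset_cube <|
    mem_feasible_of_le hz (smul_nonneg hinv.1 hz.1.1) fun i =>
      mul_le_of_le_one_left (hz.1.1 i) hinv.2
  have hle : (n : ℝ)⁻¹ • z ≤ probe r := fun i => by
    have hzi : z i ≤ r {i} := by simpa using hz.1.2 {i}
    exact (inv_mul_eq_div _ _).trans_le
      (div_le_div_of_nonneg_right (le_min (hz.2.2 i) hzi) n.cast_nonneg)
  have hray := hf.concave_of_le zero_mem_cube hz.2 hz.1.1 hinv
  rw [sub_zero, zero_add] at hray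
  have hsup := hf.mul_le_sup hf0 hzn hinv.1 hinv.2 fun i =>
    (div_le_div_of_nonneg_right (min_le_left 1 (r {i})) n.cast_nonneg).trans_eq (one_div (n : ℝ))
  change _ ≤ f (probe r ⊔ _) at hsup
  rw [sup_eq_left.2 hle] at hsup
  have hhalf : (n : ℝ)⁻¹ ≤ 1 / 2 := by
    rw [one_div]
    exact inv_anti₀ two_pos hn2
  have hvalue : (n : ℝ)⁻¹ * f z ≤ 2 * f (probe r) := by
    nlinarith [mul_nonneg (sub_nonneg.2 hinv.2) (hf0 0 zero_mem_cube), hf0 _ hzn]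
  rw [inv_mul_le_iff₀ (by linarith)] at hvalue
  linarith

/-- Parameters for `N` phases, when the optimum is at least `v` and the gradient is at most
`κ * v`: they make every error of a phase at most `v / N`. -/
noncomputable def tunedParams (n N : ℕ) (v κ : ℝ) : Params where
  η := 1 / N
  τ := 1 / (N * n * κ)
  G := κ * v
  R := ⌈2 * Real.log (2 * N * n * κ)⌉₊
  J := ⌈N * Real.log (2 * N * n * κ)⌉₊

theorem le_mul_mul (hN : 6 ≤ N) (hn : 1 ≤ n) (hκ : 1 ≤ κ) : 6 ≤ (N : ℝ) * n * κ := by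
  have hN6 : (6 : ℝ) ≤ N := Nat.ofNat_le_cast.2 hN
  have hn1 : (1 : ℝ) ≤ n := Nat.one_le_cast.2 hn
  calc (6 : ℝ) = 6 * 1 * 1 := by norm_num
    _ ≤ N * n * κ := by gcongr

theorem one_le_log_mul_mul (hN : 6 ≤ N) (hn : 1 ≤ n) (hκ : 1 ≤ κ) :
    1 ≤ Real.log (2 * N * n * κ) := by
  have := le_mul_mul hN hn hκ
  rw [Real.le_log_iff_exp_le (by linarith)]
  linarith [Real.exp_one_lt_three]

theorem lt_two_pow_ceil {x : ℝ} (hx : 1 < x) : x + 1 < 2 ^ ⌈2 * Real.log (2 * x)⌉₊ := by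
  calc x + 1 < 2 * x := by linarith
    _ ≤ 2 ^ ⌈2 * Real.log (2 * x)⌉₊ := by
        rw [← Real.log_le_log_iff (by linarith) (by positivity), Real.log_pow]
        nlinarith [Nat.le_ceil (2 * Real.log (2 * x)), Real.log_two_gt_d9]

theorem one_sub_inv_pow_ceil_le {x : ℝ} (hN : 1 ≤ N) (hx : 0 < x) :
    (1 - 1 / (N : ℝ)) ^ ⌈N * Real.log x⌉₊ ≤ 1 / x := by
  have hN0 : (0 : ℝ) < N := Nat.cast_pos.2 hN
  calc (1 - 1 / (N : ℝ)) ^ ⌈N * Real.log x⌉₊ ≤ Real.exp (-(1 / N)) ^ ⌈N * Real.log x⌉₊ :=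
        pow_le_pow_left₀ (sub_nonneg.2 (div_le_one_of_le₀ (Nat.one_le_cast.2 hN) hN0.le))
          (Real.one_sub_le_exp_neg _) _
    _ = Real.exp (-(⌈N * Real.log x⌉₊ / N)) := by
        rw [← Real.exp_nat_mul]
        ring_nf
    _ ≤ Real.exp (-Real.log x) := by
        gcongr
        rw [le_div_iff₀' hN0]
        exact Nat.le_ceil _
    _ = 1 / x := by rw [Real.exp_neg, Real.exp_log hx, one_div]

theorem tunedParams_isValid (hN : 6 ≤ N) (hn : 1 ≤ n) (hκ : 1 ≤ κ) (hv : 0 ≤ v) :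
    (tunedParams n N v κ).IsValid where
  η_nonneg := by
    change 0 ≤ 1 / (N : ℝ)
    positivity
  η_le := by
    change 6 * (1 / (N : ℝ)) ≤ 1
    rw [mul_one_div]
    exact div_le_one_of_le₀ (Nat.ofNat_le_cast.2 hN) N.cast_nonneg
  τ_nonneg := one_div_nonneg.2 (by linarith [le_mul_mul hN hn hκ])
  τ_le := by
    have := le_mul_mul hN hn hκ
    exact div_le_one_of_le₀ (by linarith) (by linarith)
  G_nonneg := mul_nonneg (by linarith) hv
  one_lt := by
    have hx := le_mul_mul hN hn hκ
    have hpow := lt_two_pow_ceil (x := N * n * κ) (by linarith)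
    rw [show 2 * ((N : ℝ) * n * κ) = 2 * N * n * κ by ring] at hpow
    change 1 < (_ - 1) * (1 / (N * n * κ))
    rw [mul_one_div, one_lt_div (by linarith)]
    exact lt_sub_iff_add_lt.2 hpow

theorem tunedParams_isTuned (hN : 6 ≤ N) (hn : 1 ≤ n) (hκ : 1 ≤ κ) (hv : 0 ≤ v) (hvO : v ≤ O)
    (hG : ∀ i, grad f 0 i ≤ κ * v) : IsTuned (tunedParams n N v κ) f O where
  toIsValid := tunedParams_isValid hN hn hκ hv
  grad_le := hG
  growth_le := by
    have : (0 : ℝ) < n := Nat.cast_pos.2 hn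
    calc (n : ℝ) * (1 / (N * n * κ) * (κ * v)) = 1 / N * v := by field_simp
      _ ≤ 1 / N * O := by gcongr
  threshold_le := by
    have hx := le_mul_mul hN hn hκ
    have : (0 : ℝ) < n := Nat.cast_pos.2 hn
    calc (n : ℝ) * (κ * v * (1 - 1 / N) ^ ⌈N * Real.log (2 * N * n * κ)⌉₊)
        ≤ n * (κ * v * (1 / (2 * N * n * κ))) := by
          gcongr
          exact one_sub_inv_pow_ceil_le (by lia) (by linarith)
      _ = 1 / 2 * (1 / N * v) := by field_simp
      _ ≤ 1 / N * O := by
          have hscaled : 1 / (N : ℝ) * v ≤ 1 / N * O := by gcongr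
          linarith [show 0 ≤ 1 / (N : ℝ) * v by positivity]

/-- The ratio of the largest partial derivative (given by the gradient `d` at the origin) to the
reference value `v`, at least `1`. For `v = 0` it is `1`. -/
noncomputable def gradientRatio (v : ℝ) (d : Fin n → ℝ) : ℝ := max 1 (‖d ⊔ 0‖ / v)

theorem le_gradientRatio_mul (hv : 0 < v) (d : Fin n → ℝ) (i : Fin n) :
    d i ≤ gradientRatio v d * v :=
  calc d i ≤ (d ⊔ 0) i := le_sup_left (a := d i)
    _ ≤ ‖d ⊔ 0‖ := (le_abs_self _).trans (norm_le_pi_norm (d ⊔ 0) i)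
    _ ≤ gradientRatio v d * v := (div_le_iff₀ hv).1 (le_max_right _ _)

theorem gradientRatio_le {d : Fin n → ℝ} {b : ℝ} (hv : 0 ≤ v) (hb : 1 ≤ b)
    (hd : ∀ i, d i ≤ b * v) : gradientRatio v d ≤ b := by
  have hbv : 0 ≤ b * v := mul_nonneg (by linarith) hv
  refine max_le hb (div_le_of_le_mul₀ hv (by linarith) <|
    (pi_norm_le_iff_of_nonneg hbv).2 fun i => ?_)
  rw [Pi.sup_apply, Pi.zero_apply, Real.norm_of_nonneg le_sup_right]
  exact sup_le (hd i) hbv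

/-- Greedy with parameters that adapt to the objective: one round queries the gradient at the
origin and the value at the probe point, which fix the scales. -/
noncomputable def adaptiveAlg (r : Finset (Fin n) → ℝ) (N : ℕ) : Algorithm n :=
  .round 2 ![toCube 0, toCube (probe r)] fun a =>
    greedyAlg r (tunedParams n N (a 1).1 (gradientRatio (a 1).1 (a 0).2)) N

/-- The parameters that the adaptive algorithm uses on the objective `f`. -/
noncomputable def adaptedParams (r : Finset (Fin n) → ℝ) (f : (Fin n → ℝ) → ℝ) (N : ℕ) : Params :=
  tunedParams n N (f (probe r)) (gradientRatio (f (probe r)) (grad f 0))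

theorem result_adaptiveAlg (hr : IsPolymatroidRank r) :
    (adaptiveAlg r N).result f = (greedyAlg r (adaptedParams r f N) N).result f := by
  have hprobe := oracle_toCube (f := f) (feasible_subset_cube (probe_mem_feasible hr))
  have hzero := oracle_toCube (f := f) zero_mem_cube
  simp only [adaptiveAlg, Algorithm.result, Matrix.cons_val_zero, Matrix.cons_val_one, hprobe,
    hzero, adaptedParams]

theorem rounds_adaptiveAlg (hr : IsPolymatroidRank r) : (adaptiveAlg r N).rounds f =
    N * ((adaptedParams r f N).J * (adaptedParams r f N).R) + 1 := by
  have hprobe := oracle_toCube (f := f) (feasible_subset_cube (probe_mem_feasible hr))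
  have hzero := oracle_toCube (f := f) zero_mem_cube
  simp only [adaptiveAlg, Algorithm.rounds, Matrix.cons_val_zero, Matrix.cons_val_one, hprobe,
    hzero, adaptedParams, rounds_greedyAlg]

theorem evaluations_adaptiveAlg (hr : IsPolymatroidRank r) : (adaptiveAlg r N).evaluations f =
    N * ((adaptedParams r f N).J * (adaptedParams r f N).R) + 2 := by
  have hprobe := oracle_toCube (f := f) (feasible_subset_cube (probe_mem_feasible hr))
  have hzero := oracle_toCube (f := f) zero_mem_cube
  simp only [adaptiveAlg, Algorithm.evaluations, Matrix.cons_val_zero, Matrix.cons_val_one, hprobe,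
    hzero, adaptedParams, evaluations_greedyAlg]

theorem evaluations_adaptiveAlg_le (hr : IsPolymatroidRank r) (hN : 6 ≤ N) (hn : 1 ≤ n) :
    ((adaptiveAlg r N).evaluations f : ℝ) ≤
      8 * (N * Real.log (2 * N * n * gradientRatio (f (probe r)) (grad f 0))) ^ 2 := by
  set L := Real.log (2 * N * n * gradientRatio (f (probe r)) (grad f 0))
  have hL1 : 1 ≤ L := one_le_log_mul_mul hN hn (le_max_left _ _)
  have hN1 : (1 : ℝ) ≤ N := Nat.one_le_cast.2 (by lia)
  have hNL : 1 ≤ N * L := one_le_mul_of_one_le_of_one_le hN1 hL1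
  have hJ : ((adaptedParams r f N).J : ℝ) ≤ 2 * (N * L) :=
    (Nat.ceil_lt_add_one (by linarith : 0 ≤ N * L)).le.trans (by linarith)
  have hR : ((adaptedParams r f N).R : ℝ) ≤ 3 * L :=
    (Nat.ceil_lt_add_one (by linarith : 0 ≤ 2 * L)).le.trans (by linarith)
  rw [evaluations_adaptiveAlg hr]
  push_cast
  calc (N : ℝ) * ((adaptedParams r f N).J * (adaptedParams r f N).R) + 2
      ≤ N * (2 * (N * L) * (3 * L)) + 2 * (N * L) ^ 2 := by
        gcongr
        linarith [one_le_pow₀ hNL (n := 2)]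
    _ = 8 * (N * L) ^ 2 := by ring

theorem adaptedParams_isTuned (hr : IsPolymatroidRank r) (hN : 6 ≤ N) (hn : 1 ≤ n)
    (hpos : 0 < f (probe r)) (hmax : IsMaxOn f (feasible r) z) :
    IsTuned (adaptedParams r f N) f (f z) :=
  tunedParams_isTuned hN hn (le_max_left _ _) hpos.le (hmax (probe_mem_feasible hr))
    (le_gradientRatio_mul hpos _)

namespace IsSmoothDR

theorem adaptive_mem_feasible (hf : IsSmoothDR f) (hf0 : ∀ x ∈ cube n, 0 ≤ f x)
    (hr : IsPolymatroidRank r) (hN : 6 ≤ N) (hn : 1 ≤ n) :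
    (adaptiveAlg r N).result f ∈ feasible r := by
  rw [result_adaptiveAlg hr]
  refine hf.greedy_mem_feasible hr (tunedParams_isValid hN hn (le_max_left _ _)
    (hf0 _ (feasible_subset_cube (probe_mem_feasible hr)))) (mul_one_div_cancel ?_).le
  exact Nat.cast_ne_zero.2 (by lia)

/-- A vanishing reference value gives no scale, but then the optimum vanishes as well. -/
theorem eq_zero_or_isTuned (hf : IsSmoothDR f) (hf0 : ∀ x ∈ cube n, 0 ≤ f x)
    (hr : IsPolymatroidRank r) (hN : 6 ≤ N) (hn : 2 ≤ n) (hz : z ∈ feasible r)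
    (hmax : IsMaxOn f (feasible r) z) : f z = 0 ∨ IsTuned (adaptedParams r f N) f (f z) := by
  rcases (hf0 _ (feasible_subset_cube (probe_mem_feasible hr))).eq_or_lt with h0 | hpos
  · left
    have hle := hf.le_value_probe (r := r) hf0 hn hz
    rw [← h0, mul_zero] at hle
    exact hle.antisymm (hf0 z hz.2)
  · exact .inr (adaptedParams_isTuned hr hN (by lia) hpos hmax)

theorem adaptive_value_general (hf : IsSmoothDR f) (hf0 : ∀ x ∈ cube n, 0 ≤ f x)
    (hr : IsPolymatroidRank r) (hN : 6 ≤ N) (hn : 2 ≤ n) (hz : z ∈ feasible r)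
    (hmax : IsMaxOn f (feasible r) z) :
    (1 / Real.exp 1 - 8 * (1 / N)) * f z ≤ f ((adaptiveAlg r N).result f) := by
  rcases hf.eq_zero_or_isTuned hf0 hr hN hn hz hmax with h0 | ht
  · rw [h0, mul_zero]
    exact hf0 _ (hf.adaptive_mem_feasible hf0 hr hN (by lia)).2
  · rw [result_adaptiveAlg hr]
    exact ht.greedy_value_general hf hf0 hr hz
      (mul_one_div_cancel (Nat.cast_ne_zero.2 (by lia)))

theorem adaptive_value_monotone (hf : IsSmoothDR f) (hf0 : ∀ x ∈ cube n, 0 ≤ f x)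
    (hr : IsPolymatroidRank r) (hN : 6 ≤ N) (hn : 2 ≤ n) (hz : z ∈ feasible r)
    (hmax : IsMaxOn f (feasible r) z) (hmono : MonotoneOn f (cube n)) :
    (1 - 1 / Real.exp 1 - 8 * (1 / N)) * f z ≤ f ((adaptiveAlg r N).result f) := by
  rcases hf.eq_zero_or_isTuned hf0 hr hN hn hz hmax with h0 | ht
  · rw [h0, mul_zero]
    exact hf0 _ (hf.adaptive_mem_feasible hf0 hr hN (by lia)).2
  · rw [result_adaptiveAlg hr]
    exact ht.greedy_value_monotone hf hf0 hr hz
      (mul_one_div_cancel (Nat.cast_ne_zero.2 (by lia))) hmono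

end IsSmoothDR

theorem rounds_adaptiveAlg_le_evaluations (hr : IsPolymatroidRank r) :
    (adaptiveAlg r N).rounds f ≤ (adaptiveAlg r N).evaluations f := by
  rw [rounds_adaptiveAlg hr, evaluations_adaptiveAlg hr]
  lia

end Adaptive

section Solver

variable {f : (Fin n → ℝ) → ℝ} {r : Finset (Fin n) → ℝ} {z : Fin n → ℝ} {ε b c : ℝ} {k : ℕ}

theorem neg_log_le_two_div_sqrt (hε : 0 < ε) : -Real.log ε ≤ 2 / √ε := by
  have hlog := Real.log_le_sub_one_of_pos (inv_pos.2 (Real.sqrt_pos.2 hε))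
  rw [Real.log_inv, Real.log_sqrt hε.le] at hlog
  rw [div_eq_mul_inv]
  linarith

theorem half_le_log {x : ℝ} (hx : 2 ≤ x) : 1 / 2 ≤ Real.log x := by
  linarith [Real.log_two_gt_d9, Real.log_le_log two_pos hx]

theorem log_le_log_div_sqrt {x : ℝ} (hε : 0 < ε) (hε1 : ε ≤ 1) (hx : 2 ≤ x) :
    Real.log x ≤ Real.log x / √ε :=
  le_div_self (by linarith [half_le_log hx]) (Real.sqrt_pos.2 hε) (Real.sqrt_le_one.2 hε1)

theorem log_div_le {x : ℝ} (hε : 0 < ε) (hε1 : ε ≤ 1) (hx : 2 ≤ x) :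
    Real.log (x / ε) ≤ 5 * (Real.log x / √ε) := by
  have hinv : 2 / √ε ≤ 4 * (Real.log x / √ε) := by
    rw [← mul_div_assoc]
    gcongr
    linarith [half_le_log hx]
  rw [Real.log_div (by linarith) hε.ne']
  linarith [neg_log_le_two_div_sqrt hε, log_le_log_div_sqrt hε hε1 hx]

theorem log_mul_pow_le {x : ℝ} (hε : 0 < ε) (hε1 : ε ≤ 1) (hx : 2 ≤ x) (hb : 1 ≤ b) (m : ℕ) :
    Real.log (b * (x / ε) ^ m) ≤ (2 * Real.log b + 5 * m) * (Real.log x / √ε) := by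
  have hratio : 1 / 2 ≤ Real.log x / √ε :=
    (half_le_log hx).trans (log_le_log_div_sqrt hε hε1 hx)
  calc Real.log (b * (x / ε) ^ m) = Real.log b + m * Real.log (x / ε) := by
        rw [Real.log_mul (by linarith) (by positivity), Real.log_pow]
    _ ≤ Real.log b * (2 * (Real.log x / √ε)) + m * (5 * (Real.log x / √ε)) := by
        gcongr
        · exact le_mul_of_one_le_right (Real.log_nonneg hb) (by linarith)
        · exact log_div_le hε hε1 hx
    _ = (2 * Real.log b + 5 * m) * (Real.log x / √ε) := by ring

theorem lt_ceil_div (hε : 0 < ε) (hε1 : ε < 1) : 8 < ⌈8 / ε⌉₊ := by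
  rw [Nat.lt_ceil, lt_div_iff₀ hε]
  push_cast
  linarith

theorem mul_one_div_ceil_le (hε : 0 < ε) : 8 * (1 / (⌈8 / ε⌉₊ : ℝ)) ≤ ε := by
  have hpos : (0 : ℝ) < ⌈8 / ε⌉₊ := Nat.cast_pos.2 (Nat.ceil_pos.2 (by positivity))
  rw [mul_one_div, div_le_iff₀ hpos, mul_comm, ← div_le_iff₀ hε]
  exact Nat.le_ceil _

theorem ceil_div_le (hε : 0 < ε) (hε1 : ε ≤ 1) : (⌈8 / ε⌉₊ : ℝ) ≤ 9 / ε :=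
  calc (⌈8 / ε⌉₊ : ℝ) ≤ 8 / ε + 1 := (Nat.ceil_lt_add_one (by positivity)).le
    _ ≤ 8 / ε + 1 / ε := by
        gcongr
        exact one_le_one_div hε hε1
    _ = 9 / ε := by ring

theorem ceil_mul_mul_le {κ : ℝ} (hε : 0 < ε) (hε1 : ε ≤ 1) (hb : 0 ≤ b)
    (hκ : κ ≤ 2 * n * (b * (n / ε) ^ k)) :
    2 * (⌈8 / ε⌉₊ : ℝ) * n * κ ≤ 36 * b * (n / ε) ^ (k + 2) :=
  calc 2 * (⌈8 / ε⌉₊ : ℝ) * n * κ ≤ 2 * ⌈8 / ε⌉₊ * n * (2 * n * (b * (n / ε) ^ k)) := by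
        gcongr
    _ ≤ 2 * (9 / ε) * n * (2 * n * (b * (n / ε) ^ k)) := by
        gcongr
        exact ceil_div_le hε hε1
    _ = 36 * b * (n / ε) ^ k * (n ^ 2 / ε) := by ring
    _ ≤ 36 * b * (n / ε) ^ k * (n ^ 2 / ε ^ 2) := by
        gcongr
        exact pow_le_of_le_one hε.le hε1 two_ne_zero
    _ = 36 * b * (n / ε) ^ (k + 2) := by ring

theorem IsSmoothDR.gradientRatio_probe_le (hf : IsSmoothDR f) (hf0 : ∀ x ∈ cube n, 0 ≤ f x)
    (hr : IsPolymatroidRank r) (hn : 2 ≤ n) (hz : z ∈ feasible r) (hb : 1 ≤ b)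
    (hgrad : ∀ i, grad f 0 i ≤ b * f z) :
    gradientRatio (f (probe r)) (grad f 0) ≤ 2 * n * b := by
  have hn2 : (2 : ℝ) ≤ n := Nat.ofNat_le_cast.2 hn
  refine gradientRatio_le (hf0 _ (feasible_subset_cube (probe_mem_feasible hr)))
    (by nlinarith) fun i => ?_
  calc grad f 0 i ≤ b * f z := hgrad i
    _ ≤ b * (2 * n * f (probe r)) := by
        gcongr
        exact hf.le_value_probe hf0 hn hz
    _ = 2 * n * b * f (probe r) := by ring

/-- The factor of `log² n / ε³` in the cost bound, when the gradient is at most `c * (n / ε) ^ k`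
times the optimum. -/
noncomputable def costFactor (c : ℝ) (k : ℕ) : ℝ :=
  648 * (2 * Real.log (36 * max c 1) + 5 * (k + 2 : ℕ)) ^ 2

theorem IsSmoothDR.evaluations_adaptiveAlg_le_costFactor (hf : IsSmoothDR f)
    (hf0 : ∀ x ∈ cube n, 0 ≤ f x) (hr : IsPolymatroidRank r) (hn : 2 ≤ n) (hε : 0 < ε)
    (hε1 : ε < 1) (hz : z ∈ feasible r)
    (hgrad : ∀ i, grad f 0 i ≤ c * (n / ε) ^ k * f z) :
    ((adaptiveAlg r ⌈8 / ε⌉₊).evaluations f : ℝ) ≤ costFactor c k * Real.log n ^ 2 / ε ^ 3 := by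
  have hn2 : (2 : ℝ) ≤ n := Nat.ofNat_le_cast.2 hn
  have hN := lt_ceil_div hε hε1
  have hc : 1 ≤ max c 1 := le_max_right _ _
  have hpow : 1 ≤ (n / ε) ^ k := one_le_pow₀ ((one_le_div hε).2 (by linarith))
  have hκ : gradientRatio (f (probe r)) (grad f 0) ≤ 2 * n * (max c 1 * (n / ε) ^ k) := by
    refine hf.gradientRatio_probe_le hf0 hr hn hz (one_le_mul_of_one_le_of_one_le hc hpow)
      fun i => (hgrad i).trans ?_
    have := hf0 z hz.2
    gcongr
    exact le_max_left _ _
  set κ := gradientRatio (f (probe r)) (grad f 0)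
  have hκ1 : 1 ≤ κ := le_max_left _ _
  have hM := ceil_mul_mul_le (n := n) hε hε1.le (by linarith) hκ
  have hM0 : 0 < 2 * (⌈8 / ε⌉₊ : ℝ) * n * κ := by
    linarith [le_mul_mul (n := n) (by lia : 6 ≤ ⌈8 / ε⌉₊) (by lia) hκ1]
  calc ((adaptiveAlg r ⌈8 / ε⌉₊).evaluations f : ℝ)
      ≤ 8 * (⌈8 / ε⌉₊ * Real.log (2 * ⌈8 / ε⌉₊ * n * κ)) ^ 2 :=
        evaluations_adaptiveAlg_le hr (by lia) (by lia)
    _ ≤ 8 * (9 / ε * ((2 * Real.log (36 * max c 1) + 5 * (k + 2 : ℕ)) *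
          (Real.log n / √ε))) ^ 2 := by
        have hlog := one_le_log_mul_mul (n := n) (by lia : 6 ≤ ⌈8 / ε⌉₊) (by lia) hκ1
        gcongr
        · exact ceil_div_le hε hε1.le
        · exact (Real.log_le_log hM0 hM).trans
            (log_mul_pow_le hε hε1.le hn2 (by linarith) (k + 2))
    _ = costFactor c k * Real.log n ^ 2 / ε ^ 3 := by
        rw [costFactor, mul_pow, mul_pow, div_pow, div_pow, Real.sq_sqrt hε.le]
        field_simp
        ring

/-- The algorithm with error parameter `ε`. Nothing has to be done for `1 ≤ ε`, where the
guarantees are trivial. -/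
noncomputable def solver (r : Finset (Fin n) → ℝ) (ε : ℝ) : Algorithm n :=
  if ε < 1 then adaptiveAlg r ⌈8 / ε⌉₊ else .output 0

theorem IsSmoothDR.solver_mem_feasible (hf : IsSmoothDR f) (hf0 : ∀ x ∈ cube n, 0 ≤ f x)
    (hr : IsPolymatroidRank r) (hn : 1 ≤ n) (hε : 0 < ε) :
    (solver r ε).result f ∈ feasible r := by
  rw [solver]
  split_ifs with hε1
  · exact hf.adaptive_mem_feasible hf0 hr (by linarith [lt_ceil_div hε hε1]) hn
  · exact zero_mem_feasible hr

theorem IsSmoothDR.solver_value_monotone (hf : IsSmoothDR f) (hf0 : ∀ x ∈ cube n, 0 ≤ f x)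
    (hr : IsPolymatroidRank r) (hn : 2 ≤ n) (hε : 0 < ε) (hz : z ∈ feasible r)
    (hmax : IsMaxOn f (feasible r) z) (hmono : MonotoneOn f (cube n)) :
    (1 - 1 / Real.exp 1 - ε) * f z ≤ f ((solver r ε).result f) := by
  have hfz := hf0 z hz.2
  rw [solver]
  split_ifs with hε1
  · refine le_trans ?_ (hf.adaptive_value_monotone hf0 hr (by linarith [lt_ceil_div hε hε1]) hn
      hz hmax hmono)
    gcongr
    exact mul_one_div_ceil_le hε
  · refine (mul_nonpos_of_nonpos_of_nonneg ?_ hfz).trans (hf0 0 zero_mem_cube)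
    linarith [one_div_pos.2 (Real.exp_pos 1)]

theorem IsSmoothDR.solver_value_general (hf : IsSmoothDR f) (hf0 : ∀ x ∈ cube n, 0 ≤ f x)
    (hr : IsPolymatroidRank r) (hn : 2 ≤ n) (hε : 0 < ε) (hz : z ∈ feasible r)
    (hmax : IsMaxOn f (feasible r) z) :
    (1 / Real.exp 1 - ε) * f z ≤ f ((solver r ε).result f) := by
  have hfz := hf0 z hz.2
  rw [solver]
  split_ifs with hε1
  · refine le_trans ?_ (hf.adaptive_value_general hf0 hr (by linarith [lt_ceil_div hε hε1]) hn
      hz hmax)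
    gcongr
    exact mul_one_div_ceil_le hε
  · refine (mul_nonpos_of_nonpos_of_nonneg ?_ hfz).trans (hf0 0 zero_mem_cube)
    linarith [div_le_one_of_le₀ (Real.one_le_exp zero_le_one) (Real.exp_pos 1).le]

theorem IsSmoothDR.evaluations_solver_le (hf : IsSmoothDR f) (hf0 : ∀ x ∈ cube n, 0 ≤ f x)
    (hr : IsPolymatroidRank r) (hn : 2 ≤ n) (hε : 0 < ε) (hz : z ∈ feasible r)
    (hgrad : ∀ i, grad f 0 i ≤ c * (n / ε) ^ k * f z) :
    ((solver r ε).evaluations f : ℝ) ≤ costFactor c k * Real.log n ^ 2 / ε ^ 3 := by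
  rw [solver]
  split_ifs with hε1
  · exact hf.evaluations_adaptiveAlg_le_costFactor hf0 hr hn hε hε1 hz hgrad
  · rw [Algorithm.evaluations, Nat.cast_zero, costFactor]
    positivity

theorem rounds_solver_le_evaluations (hr : IsPolymatroidRank r) :
    (solver r ε).rounds f ≤ (solver r ε).evaluations f := by
  rw [solver]
  split_ifs
  · exact rounds_adaptiveAlg_le_evaluations hr
  · exact le_rfl

end Solver

end DRMax

open DRMax in
theorem theorem1_general :
    (∃ C : ℝ → ℕ → ℝ, ∀ n : ℕ, 2 ≤ n → ∀ ε : ℝ, 0 < ε →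
      ∀ r : Finset (Fin n) → ℝ, IsPolymatroidRank r →
      ∃ A : Algorithm n,
        ∀ f : (Fin n → ℝ) → ℝ,
          (∀ x ∈ cube n, 0 ≤ f x) →
          DifferentiableOn ℝ f (cube n) →
          IsDRSubmodular f →
          ∀ xopt ∈ feasible r, IsMaxOn f (feasible r) xopt →
            A.result f ∈ feasible r ∧
            (MonotoneOn f (cube n) →
              (1 - 1 / Real.exp 1 - ε) * f xopt ≤ f (A.result f)) ∧
            (1 / Real.exp 1 - ε) * f xopt ≤ f (A.result f) ∧
            ∀ (c : ℝ) (k : ℕ),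
              (∀ i : Fin n, grad f 0 i ≤ c * ((n : ℝ) / ε) ^ k * f xopt) →
              (A.rounds f : ℝ) ≤ C c k * Real.log n ^ 2 / ε ^ 3 ∧
              (A.evaluations f : ℝ) ≤ C c k * Real.log n ^ 2 / ε ^ 3) ∧
    (∀ (n : ℕ) (r : Finset (Fin n) → ℝ), IsPolymatroidRank r → (∀ i, 1 ≤ r {i}) →
      ∀ g : Finset (Fin n) → ℝ, 0 ≤ g ∅ → IsSubmodular g →
        ∀ xopt, IsMaxOn (multilinearExt g) (feasible r) xopt →
          ∀ x ∈ cube n, ∀ i : Fin n, grad (multilinearExt g) x i ≤ multilinearExt g xopt) := by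
  refine ⟨⟨costFactor, fun n hn ε hε r hr => ⟨solver r ε, fun f hf0 hdiff hdr z hz hmax => ?_⟩⟩,
    fun n r hr hloop g hg0 hg z hmax x hx i => ?_⟩
  · have hf : IsSmoothDR f := ⟨hdiff, hdr⟩
    refine ⟨hf.solver_mem_feasible hf0 hr (by lia) hε,
      hf.solver_value_monotone hf0 hr hn hε hz hmax,
      hf.solver_value_general hf0 hr hn hε hz hmax, fun c k hgrad => ?_⟩
    have heval := hf.evaluations_solver_le hf0 hr hn hε hz hgrad
    exact ⟨(Nat.cast_le.2 (rounds_solver_le_evaluations hr)).trans heval, heval⟩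
  · calc grad (multilinearExt g) x i ≤ g {i} := grad_multilinearExt_le hg0 hg hx i
      _ = multilinearExt g (Pi.single i 1) := (multilinearExt_single g i).symm
      _ ≤ multilinearExt g z := hmax (single_mem_feasible hr (hloop i))

theorem theorem1 :
    (∀ (c : ℝ) (k : ℕ), ∃ C : ℝ, ∀ n : ℕ, 2 ≤ n → ∀ ε : ℝ, 0 < ε →
      ∀ r : Finset (Fin n) → ℝ, DRMax.IsPolymatroidRank r →
      ∃ A : DRMax.Algorithm n,
        ∀ f : (Fin n → ℝ) → ℝ,
          (∀ x ∈ DRMax.cube n, 0 ≤ f x) →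
          DifferentiableOn ℝ f (DRMax.cube n) →
          DRMax.IsDRSubmodular f →
          ∀ xopt ∈ DRMax.feasible r, IsMaxOn f (DRMax.feasible r) xopt →
            A.result f ∈ DRMax.feasible r ∧
            (MonotoneOn f (DRMax.cube n) →
              (1 - 1 / Real.exp 1 - ε) * f xopt ≤ f (A.result f)) ∧
            (1 / Real.exp 1 - ε) * f xopt ≤ f (A.result f) ∧
            ((∀ x ∈ DRMax.cube n, ∀ i : Fin n,
                DRMax.grad f x i ≤ c * ((n : ℝ) / ε) ^ k * f xopt) →
              (A.rounds f : ℝ) ≤ C * Real.log n ^ 2 / ε ^ 3 ∧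
              (A.evaluations f : ℝ) ≤ C * Real.log n ^ 2 / ε ^ 3)) ∧
    (∀ (n : ℕ) (r : Finset (Fin n) → ℝ), DRMax.IsPolymatroidRank r → (∀ i, 1 ≤ r {i}) →
      ∀ g : Finset (Fin n) → ℝ, (∀ S, 0 ≤ g S) → DRMax.IsSubmodular g →
        ∀ xopt ∈ DRMax.feasible r,
          IsMaxOn (DRMax.multilinearExt g) (DRMax.feasible r) xopt →
            ∀ x ∈ DRMax.cube n, ∀ i : Fin n,
              DRMax.grad (DRMax.multilinearExt g) x i ≤ DRMax.multilinearExt g xopt) := by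
  obtain ⟨⟨C, hC⟩, hmultilinear⟩ := theorem1_general
  refine ⟨fun c k => ⟨C c k, fun n hn ε hε r hr => ?_⟩, fun n r hr hloop g hg0 hg z _ =>
    hmultilinear n r hr hloop g (hg0 ∅) hg z⟩
  obtain ⟨A, hA⟩ := hC n hn ε hε r hr
  refine ⟨A, fun f hf0 hdiff hdr z hz hmax => ?_⟩
  obtain ⟨hmem, hmono, hgeneral, hcost⟩ := hA f hf0 hdiff hdr z hz hmax
  exact ⟨hmem, hmono, hgeneral, fun hgrad => hcost c k (hgrad 0 DRMax.zero_mem_cube)⟩
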